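/- Hypergraphs are finite; edges may be repeated, and a vertex may occur several times in one edge. The degree $\deg_{\mathcal G}(v)$ of a vertex $v$ is the number of its occurrences, with multiplicity, among all edges of $\mathcal G$. For an edge-coloured hypergraph $\mathcal G$, let $\mathcal G(j)$ be the spanning sub-hypergraph formed by the edges of colour $j$. Let $\lambda K_n^h$ be the hypergraph on $n$ vertices in which every $h$-subset of the vertices is an edge of multiplicity $\lambda$. A vertex $\alpha$ of a connected hypergraph $W$ is a cut vertex if $W=I\cup J$ for two sub-hypergraphs $I,J$, each with at least one edge, having no common edge and having $\alpha$ as their only common vertex. An $\alpha$-wing of $\mathcal G$ is a connected sub-hypergraph $W$ of $\mathcal G$ that contains $\alpha$ and has at least one edge, such that $\alpha$ is not a cut vertex of $W$ and no edge of $\mathcal G$ outside $W$ is incident with a vertex of $W$ other than $\alpha$. Let $\omega_\alpha(\mathcal G)$ be the number of $\alpha$-wings of $\mathcal G$. Let $n,m,h,r,\lambda$ be positive integers with $n>m>h$ such that $k:=\lambda\binom{n-1}{h-1}/r$ is an integer. View $\lambda K_m^h$ as a sub-hypergraph of $\lambda K_n^h$. Let $\mathcal H=\widetilde{\lambda K_m^h}$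 be the hypergraph obtained from $\lambda K_m^h$ by adding one new vertex $\alpha$ and, for every $i\in\{1,\dots,h\}$ and every set $X$ of $h-i$ vertices of $\lambda K_m^h$, adding $\lambda\binom{n-m}{i}$ copies of the edge $\{\alpha^i\}\cup X$, in which $\alpha$ occurs $i$ times; the added edges are called new. (So $\mathcal H$ is the amalgamation of $\lambda K_n^h$ obtained by identifying $n-m$ vertices.) A partial $r$-factorization of $\lambda K_m^h$ is a colouring of its edges with $k$ colours, some possibly unused, in which every vertex has degree at most $r$ in every colour. A connected $r$-factorization of $\lambda K_n^h$ is a colouring of its edges with $k$ colours in which every colour class is connected and spanning and every vertex has degree $r$ in every colour. **Corollary.** A given partial $r$-factorization of $\lambda K_m^h$ can be extended to a connected $r$-factorization of $\lambda K_n^h$ if and only if the new edges of $\mathcal H$ can be coloured with the same $k$ colours (the edges of $\lambda K_m^h$ keeping their given colours) such that for every colour $j$: 1. $\deg_{\mathcal H(j)}(v)=r$ for every vertex $v\ne\alpha$, and $\deg_{\mathcal H(j)}(\alpha)=r(n-m)$; 2. $\mathcal H(j)$ is connected; 3. $\omega_\alpha(\mathcal H(j))\le (r-1)(n-m)+1$.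 -/

import Mathlib

/-- A finite hypergraph with vertex set `V` and (labelled) edges `E`: every edge is a multiset of
vertices, and different edges may carry the same multiset. -/
structure MultiHypergraph (V E : Type*) where
  ends : E → Multiset V

namespace MultiHypergraph

variable {V E : Type*}

/-- A sub-hypergraph: a set of vertices and a set of edges all of whose vertices are chosen. -/
structure Sub (G : MultiHypergraph V E) where
  verts : Finset V
  edges : Finset E
  ends_mem : ∀ e ∈ edges, ∀ v ∈ G.ends e, v ∈ verts

namespace Sub

variable {G : MultiHypergraph V E}

/-- The number of occurrences of `v`, with multiplicity, among all edges of the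
sub-hypergraph. -/
def degree [DecidableEq V] (W : G.Sub) (v : V) : ℕ :=
  ∑ e ∈ W.edges, (G.ends e).count v

/-- Any two vertices are joined by a chain of edges; a connected hypergraph has a vertex. -/
def Connected (W : G.Sub) : Prop :=
  W.verts.Nonempty ∧
    ∀ u ∈ W.verts, ∀ v ∈ W.verts,
      Relation.ReflTransGen (fun x y => ∃ e ∈ W.edges, x ∈ G.ends e ∧ y ∈ G.ends e) u v

/-- `W` has at least one edge. -/
def Nontrivial (W : G.Sub) : Prop := W.edges.Nonempty

/-- `a` is a cut vertex of `W`: `W` is the union of two non-trivial sub-hypergraphs that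
share the vertex `a`, no other vertex, and no edge. -/
def IsCutVertex [DecidableEq V] [DecidableEq E] (W : G.Sub) (a : V) : Prop :=
  ∃ I J : G.Sub, I.Nontrivial ∧ J.Nontrivial ∧
    I.verts ∪ J.verts = W.verts ∧ I.edges ∪ J.edges = W.edges ∧
    I.verts ∩ J.verts = {a} ∧ I.edges ∩ J.edges = ∅

/-- `W` is an `a`-wing of the hypergraph `C`. -/
structure IsWing [DecidableEq V] [DecidableEq E] (C : G.Sub) (a : V) (W : G.Sub) : Prop where
  verts_subset : W.verts ⊆ C.verts
  edges_subset : W.edges ⊆ C.edges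
  mem_verts : a ∈ W.verts
  nontrivial : W.Nontrivial
  connected : W.Connected
  not_isCutVertex : ¬ W.IsCutVertex a
  /-- No other edge of `C` is incident with a vertex of `W` different from `a`. -/
  closed : ∀ e ∈ C.edges, e ∉ W.edges → ∀ v ∈ W.verts, v ≠ a → v ∉ G.ends e

/-- The number of `a`-wings of `C`. -/
noncomputable def wingCount [DecidableEq V] [DecidableEq E] (C : G.Sub) (a : V) : ℕ :=
  {W : G.Sub | C.IsWing a W}.ncard

end Sub

/-- The spanning sub-hypergraph formed by the edges of colour `j`. -/
def colorClass [Fintype V] [Fintype E] {k : ℕ} (G : MultiHypergraph V E) (c : E → Fin k)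
    (j : Fin k) : G.Sub where
  verts := Finset.univ
  edges := Finset.univ.filter fun e => c e = j
  ends_mem := fun _ _ v _ => Finset.mem_univ v

/-- Every vertex has degree at most `r` in every colour class. -/
def IsPartialFactorization [Fintype V] [Fintype E] [DecidableEq V] {k : ℕ}
    (G : MultiHypergraph V E) (r : ℕ) (c : E → Fin k) : Prop :=
  ∀ j v, (G.colorClass c j).degree v ≤ r

/-- Every colour class is a connected `r`-factor. -/
def IsConnectedFactorization [Fintype V] [Fintype E] [DecidableEq V] {k : ℕ}
    (G : MultiHypergraph V E) (r : ℕ) (c : E → Fin k) : Prop :=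
  ∀ j, (∀ v, (G.colorClass c j).degree v = r) ∧ (G.colorClass c j).Connected

/-- The edges of `lam • K_V^h`: `lam` copies of each `h`-subset of `V`. -/
abbrev CompleteEdge (lam h : ℕ) (V : Type*) : Type _ :=
  Fin lam × {s : Finset V // s.card = h}

/-- The complete `lam`-fold `h`-uniform hypergraph on the vertex set `V`. -/
def complete (lam h : ℕ) (V : Type*) : MultiHypergraph V (CompleteEdge lam h V) where
  ends e := e.2.1.val

/-- The copies of the `h`-subsets of `Fin m` as copies of `h`-subsets of `Fin n`. -/
def CompleteEdge.castLE {lam h m n : ℕ} (hmn : m ≤ n) (e : CompleteEdge lam h (Fin m)) :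
    CompleteEdge lam h (Fin n) :=
  (e.1, ⟨e.2.1.map (Fin.castLEEmb hmn), by rw [Finset.card_map, e.2.2]⟩)

/-- The colouring `d` of the edges of `lam • K_n^h` extends the colouring `c` of the edges of
`lam • K_m^h`. -/
def Extends {lam h m n k : ℕ} (hmn : m ≤ n) (d : CompleteEdge lam h (Fin n) → Fin k)
    (c : CompleteEdge lam h (Fin m) → Fin k) : Prop :=
  ∀ e, d (CompleteEdge.castLE hmn e) = c e

/-- The new edges of the amalgamation: for every set `X` of fewer than `h` old vertices, with
`i = h - |X|`, there are `lam * (n - m).choose i` copies of the edge `α ^ i ∪ X`. -/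
abbrev NewEdge (lam h m n : ℕ) : Type :=
  Σ X : {X : Finset (Fin m) // X.card < h}, Fin (lam * (n - m).choose (h - X.1.card))

/-- The amalgamation of `lam • K_n^h` obtained by identifying `n - m` of its vertices with one
vertex `α = none`; the edges of `lam • K_m^h` are the old edges. -/
def amalgam (lam h m n : ℕ) :
    MultiHypergraph (Option (Fin m)) (CompleteEdge lam h (Fin m) ⊕ NewEdge lam h m n) where
  ends
    | Sum.inl e => e.2.1.val.map some
    | Sum.inr e => Multiset.replicate (h - e.1.1.card) none + e.1.1.val.map some

end MultiHypergraph

/-! Necessity: identify the vertices `m, …, n - 1` of a connected factorization. Degrees add up and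
connectedness survives. The wings at the apex are the classes of edges linked through ordinary
vertices (`wingCount_colorClass`). In each colour, the bipartite graph between the `n - m`
identified vertices and these classes is connected and has at most `r (n - m)` edges, hence at most
`r (n - m) + 1` nodes; this is condition 3 (`card_image_linkClass_le`).

Sufficiency: vertices are split off the apex one at a time, with the pieces hanging at the apex kept
under control. If the apex stands for `p + 1` vertices, the next vertex should take exactly the `(p
+ 1)`-th part of the apex occurrences in every edge type and every colour, and at most that part,
rounded up, in every piece. Taking this part of everything is a fractional flow from types through
pieces to colours, and `exists_integral_flow` rounds it (`exists_balanced_selection`). The share of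
the types gives the right multiplicities by Pascal's rule, and that of the colours gives degree `r`.

The new vertex fuses the pieces it meets into one, and enough pieces are met for the bound to
persist (`card_le_add_card_touched`). The fused piece must still contain the apex. For this, the
network forces the new vertex to meet a piece with at least two apex occurrences, and the rounded-up
share cannot exhaust such a piece (`exists_split`). Iteration (`exists_detachment`) yields every
`h`-subset exactly `lam` times, and an edge bijection fixing the old edges transports the colouring.
-/

namespace MultiHypergraph

open Finset

/-! ### Integrality of flows. -/

section Flow

variable {A N : Type*} [Fintype A] [DecidableEq N]

/-- The net outflow of `x` at the node `v`, where the arc `a` leads from `s a` to `t a`. -/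
def divergence (s t : A → N) (v : N) : (A → ℚ) →ₗ[ℚ] ℚ where
  toFun x := ∑ a with s a = v, x a - ∑ a with t a = v, x a
  map_add' x y := by simp only [Pi.add_apply, sum_add_distrib]; ring
  map_smul' q x := by simp only [Pi.smul_apply, smul_eq_mul, ← mul_sum, RingHom.id_apply]; ring

theorem divergence_apply (s t : A → N) (v : N) (x : A → ℚ) :
    divergence s t v x = ∑ a with s a = v, x a - ∑ a with t a = v, x a := rfl

theorem sum_divergence (s t : A → N) (B : Finset N) (x : A → ℚ)
    (hB : ∀ a, x a ≠ 0 → s a ∈ B ∧ t a ∈ B) : ∑ v ∈ B, divergence s t v x = 0 := by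
  simp only [divergence_apply, sum_sub_distrib, sum_filter]
  rw [sum_comm, sum_comm (s := B), ← sum_sub_distrib]
  refine sum_eq_zero fun a _ => ?_
  rw [sum_ite_eq, sum_ite_eq]
  by_cases ha : x a = 0
  · simp [ha]
  · simp [(hB a ha).1, (hB a ha).2]

theorem exists_int_eq_sum {A : Type*} (B : Finset A) (x : A → ℚ) (hx : ∀ a ∈ B, ∃ z : ℤ, x a = z) :
    ∃ z : ℤ, ∑ a ∈ B, x a = z := by
  choose! z hz using hx
  exact ⟨∑ a ∈ B, z a, by rw [sum_congr rfl hz]; push_cast; rfl⟩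

-- A single fractional arc at `v` would be a combination of integers. A loop is counted at both of
-- its ends.
open Classical in
theorem two_le_card_fractional (s t : A → N) (x : A → ℚ) (v : N)
    (hv : ∃ z : ℤ, divergence s t v x = z) (F : Finset A)
    (hF : ∀ a, a ∈ F ↔ ¬ ∃ z : ℤ, x a = z) (hne : ∃ a ∈ F, s a = v ∨ t a = v) :
    2 ≤ #{a ∈ F | s a = v} + #{a ∈ F | t a = v} := by
  have key : ∀ (s t : A → N), (∃ z : ℤ, divergence s t v x = z) → (∃ a ∈ F, s a = v) →
      2 ≤ #{a ∈ F | s a = v} + #{a ∈ F | t a = v} := by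
    intro s t ⟨z, hz⟩ ⟨a, haF, ha⟩
    by_contra hlt
    have hpos : 0 < #{a ∈ F | s a = v} := card_pos.mpr ⟨a, by simp [haF, ha]⟩
    have h1 : #{a ∈ F | s a = v} = 1 := by omega
    have h0 : #{a ∈ F | t a = v} = 0 := by omega
    obtain ⟨b, hb⟩ := card_eq_one.mp h1
    have hab : ∀ c, c ∈ F → s c = v → c = a := by
      intro c hc hcv
      have h2 : c ∈ ({b} : Finset A) := by rw [← hb]; simp [hc, hcv]
      have h3 : a ∈ ({b} : Finset A) := by rw [← hb]; simp [haF, ha]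
      rw [mem_singleton] at h2 h3
      rw [h2, h3]
    rw [card_eq_zero, filter_eq_empty_iff] at h0
    rw [divergence_apply, ← add_sum_erase _ _ (by simp [ha] : a ∈ ({a | s a = v} : Finset A))] at hz
    obtain ⟨z1, hz1⟩ := exists_int_eq_sum (({a | s a = v} : Finset A).erase a) x (by
      intro c hc
      by_contra hcx
      simp only [mem_erase, mem_filter, mem_univ, true_and] at hc
      exact hc.1 (hab c ((hF c).2 hcx) hc.2))
    obtain ⟨z2, hz2⟩ := exists_int_eq_sum ({a | t a = v} : Finset A) x (by
      intro c hc
      by_contra hcx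
      simp only [mem_filter, mem_univ, true_and] at hc
      exact h0 ((hF c).2 hcx) hc)
    refine (hF a).1 haF ⟨z - z1 + z2, ?_⟩
    push_cast
    rw [hz1, hz2] at hz
    linarith
  obtain ⟨a, haF, ha | ha⟩ := hne
  · exact key s t hv ⟨a, haF, ha⟩
  · rw [add_comm]
    refine key t s ?_ ⟨a, haF, ha⟩
    obtain ⟨z, hz⟩ := hv
    exact ⟨-z, by rw [divergence_apply] at hz ⊢; push_cast; linarith⟩

-- Dimension count: there are at least as many fractional arcs as nodes touched by them, and the
-- conservation laws at these nodes are linearly dependent.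
open Classical in
theorem exists_circulation_fractional (s t : A → N) (x : A → ℚ)
    (hx : ∀ v, ∃ z : ℤ, divergence s t v x = z) (F : Finset A)
    (hF : ∀ a, a ∈ F ↔ ¬ ∃ z : ℤ, x a = z) (hne : F.Nonempty) :
    ∃ y : A → ℚ, y ≠ 0 ∧ (∀ a, a ∉ F → y a = 0) ∧ ∀ v, divergence s t v y = 0 := by
  set B : Finset N := F.image s ∪ F.image t with hB
  -- Counting the ends of fractional arcs gives `2 * #B ≤ 2 * #F`.
  have hcard : #B ≤ #F := by
    have h1 : #F = ∑ v ∈ B, #{a ∈ F | s a = v} :=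
      card_eq_sum_card_fiberwise fun a ha => by
        rw [hB]; exact mem_coe.2 (mem_union_left _ (mem_image_of_mem _ ha))
    have h2 : #F = ∑ v ∈ B, #{a ∈ F | t a = v} :=
      card_eq_sum_card_fiberwise fun a ha => by
        rw [hB]; exact mem_coe.2 (mem_union_right _ (mem_image_of_mem _ ha))
    have h3 : ∑ _v ∈ B, 2 ≤ ∑ v ∈ B, (#{a ∈ F | s a = v} + #{a ∈ F | t a = v}) := by
      refine sum_le_sum fun v hv => two_le_card_fractional s t x v (hx v) F hF ?_
      rw [hB, mem_union, mem_image, mem_image] at hv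
      rcases hv with ⟨a, ha, hav⟩ | ⟨a, ha, hav⟩
      · exact ⟨a, ha, Or.inl hav⟩
      · exact ⟨a, ha, Or.inr hav⟩
    rw [sum_add_distrib, ← h1, ← h2, sum_const, smul_eq_mul] at h3
    omega
  obtain ⟨a₀, ha₀⟩ := hne
  have hv₀ : s a₀ ∈ B := mem_union_left _ (mem_image_of_mem _ ha₀)
  let ext : (F → ℚ) →ₗ[ℚ] (A → ℚ) :=
    LinearMap.pi fun a => if ha : a ∈ F then LinearMap.proj ⟨a, ha⟩ else 0
  -- The equation at `s a₀` is omitted: the divergences over `B` sum to zero, so it follows from the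
  -- others. This leaves fewer equations than unknowns.
  let f : (F → ℚ) →ₗ[ℚ] (B.erase (s a₀) → ℚ) :=
    LinearMap.pi fun v => (divergence s t v.1).comp ext
  have hker : LinearMap.ker f ≠ ⊥ := by
    apply LinearMap.ker_ne_bot_of_finrank_lt
    rw [Module.finrank_fintype_fun_eq_card, Module.finrank_fintype_fun_eq_card,
      Fintype.card_coe, Fintype.card_coe, card_erase_of_mem hv₀]
    have := card_pos.mpr ⟨_, hv₀⟩
    omega
  obtain ⟨u, hu, hu0⟩ := (Submodule.ne_bot_iff _).mp hker
  have hext : ∀ a (ha : a ∈ F), ext u a = u ⟨a, ha⟩ := by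
    intro a ha
    simp [ext, ha]
  have hext0 : ∀ a, a ∉ F → ext u a = 0 := by
    intro a ha
    simp [ext, ha]
  have hdiv : ∀ v ∈ B.erase (s a₀), divergence s t v (ext u) = 0 := fun v hv =>
    congrFun (LinearMap.mem_ker.mp hu) ⟨v, hv⟩
  refine ⟨ext u, ?_, hext0, fun v => ?_⟩
  · intro h0
    apply hu0
    ext a
    rw [← hext a.1 a.2, h0]
    rfl
  · by_cases hv : v ∈ B
    · by_cases hvs : v = s a₀
      · have h1 := sum_divergence s t B (ext u) (by
          intro a ha
          have haF : a ∈ F := by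
            by_contra h
            exact ha (hext0 a h)
          exact ⟨mem_union_left _ (mem_image_of_mem _ haF),
            mem_union_right _ (mem_image_of_mem _ haF)⟩)
        rw [← add_sum_erase _ _ hv₀, sum_eq_zero hdiv, add_zero] at h1
        rw [hvs, h1]
      · exact hdiv v (mem_erase.2 ⟨hvs, hv⟩)
    · rw [divergence_apply, sum_eq_zero, sum_eq_zero, sub_zero]
      · intro a ha
        refine hext0 a fun haF => hv ?_
        rw [← (mem_filter.1 ha).2]
        exact mem_union_right _ (mem_image_of_mem _ haF)
      · intro a ha
        refine hext0 a fun haF => hv ?_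
        rw [← (mem_filter.1 ha).2]
        exact mem_union_left _ (mem_image_of_mem _ haF)

/-- Moving from `x` in the direction `y` one reaches the boundary of the integer box of `x`. -/
theorem exists_step_to_integer (x y : A → ℚ) (hy : y ≠ 0) :
    ∃ q : ℚ, (∀ a, (⌊x a⌋ : ℚ) ≤ x a + q * y a ∧ x a + q * y a ≤ ⌈x a⌉) ∧
      ∃ a, y a ≠ 0 ∧ ∃ z : ℤ, x a + q * y a = z := by
  classical
  -- The length of the step at which arc `a` reaches the integer it moves towards; the shortest such
  -- step is taken.
  let room : A → ℚ := fun a => if 0 < y a then (⌈x a⌉ - x a) / y a else (⌊x a⌋ - x a) / y a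
  obtain ⟨a₁, ha₁⟩ := Function.ne_iff.mp hy
  obtain ⟨a₀, ha₀, hmin⟩ :=
    exists_min_image ({a | y a ≠ 0} : Finset A) room ⟨a₁, by simpa using ha₁⟩
  have ha₀' : y a₀ ≠ 0 := by simpa using ha₀
  have hroom : ∀ a, y a ≠ 0 → 0 ≤ room a := by
    intro a ha
    simp only [room]
    split_ifs with h
    · exact div_nonneg (sub_nonneg.2 (Int.le_ceil _)) h.le
    · exact div_nonneg_of_nonpos (sub_nonpos.2 (Int.floor_le _)) (not_lt.1 h)
  have h0 := hroom a₀ ha₀'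
  refine ⟨room a₀, fun a => ?_, a₀, ha₀', ?_⟩
  · by_cases ha : y a = 0
    · simp [ha, Int.floor_le, Int.le_ceil]
    · have hle : room a₀ ≤ room a := hmin a (by simpa using ha)
      rcases lt_or_gt_of_ne ha with hneg | hpos
      · have hr : room a = (⌊x a⌋ - x a) / y a := by simp [room, not_lt.2 hneg.le]
        rw [hr, le_div_iff_of_neg hneg] at hle
        have := mul_nonpos_of_nonneg_of_nonpos h0 hneg.le
        exact ⟨by linarith, by linarith [Int.le_ceil (x a)]⟩
      · have hr : room a = (⌈x a⌉ - x a) / y a := by simp [room, hpos]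
        rw [hr, le_div_iff₀ hpos] at hle
        have := mul_nonneg h0 hpos.le
        exact ⟨by linarith [Int.floor_le (x a)], by linarith⟩
  · rcases lt_or_gt_of_ne ha₀' with hneg | hpos
    · refine ⟨⌊x a₀⌋, ?_⟩
      have hr : room a₀ = (⌊x a₀⌋ - x a₀) / y a₀ := by simp [room, not_lt.2 hneg.le]
      rw [hr, div_mul_cancel₀ _ ha₀']
      ring
    · refine ⟨⌈x a₀⌉, ?_⟩
      have hr : room a₀ = (⌈x a₀⌉ - x a₀) / y a₀ := by simp [room, hpos]
      rw [hr, div_mul_cancel₀ _ ha₀']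
      ring

/-- A rational flow with integral divergences can be rounded to an integral one. -/
theorem exists_integral_flow (s t : A → N) (x : A → ℚ)
    (hx : ∀ v, ∃ z : ℤ, divergence s t v x = z) :
    ∃ z : A → ℤ, (∀ a, ⌊x a⌋ ≤ z a ∧ z a ≤ ⌈x a⌉) ∧
      ∀ v, divergence s t v (fun a => (z a : ℚ)) = divergence s t v x := by
  classical
  obtain ⟨c, hc⟩ : ∃ c, #({a | ¬ ∃ z : ℤ, x a = z} : Finset A) = c := ⟨_, rfl⟩
  induction c using Nat.strong_induction_on generalizing x with
  | _ c ih =>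
    by_cases hne : ({a | ¬ ∃ z : ℤ, x a = z} : Finset A).Nonempty
    · obtain ⟨y, hy0, hyF, hydiv⟩ := exists_circulation_fractional s t x hx _ (by simp) hne
      have hxy : ∀ a, y a ≠ 0 → ¬ ∃ z : ℤ, x a = z := by
        intro a ha hz
        exact ha (hyF a (by simpa using hz))
      obtain ⟨q, hq, a₀, ha₀, hz₀⟩ := exists_step_to_integer x y hy0
      have hdiv : ∀ v, divergence s t v (x + q • y) = divergence s t v x := by
        intro v
        rw [map_add, map_smul, hydiv, smul_zero, add_zero]
      have hval : ∀ a, (x + q • y) a = x a + q * y a := fun a => rfl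
      -- Integral arcs are not moved and `a₀` becomes integral, so fewer arcs are fractional.
      obtain ⟨z, hz, hzdiv⟩ := ih _ (by
        rw [← hc]
        refine card_lt_card (Finset.ssubset_iff_of_subset ?_ |>.2 ⟨a₀, ?_, ?_⟩)
        · intro a ha
          simp only [mem_filter, mem_univ, true_and] at ha ⊢
          rintro ⟨z, hz⟩
          refine ha ⟨z, ?_⟩
          rw [hval, hz]
          by_contra hne
          exact hxy a (fun h => hne (by simp [h])) ⟨z, hz⟩
        · simpa using hxy a₀ ha₀
        · simpa [hval] using hz₀) (x + q • y) (fun v => by rw [hdiv]; exact hx v) rfl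
      refine ⟨z, fun a => ⟨?_, ?_⟩, fun v => by rw [hzdiv, hdiv]⟩
      · exact (Int.le_floor.2 (hq a).1).trans (hz a).1
      · exact (hz a).2.trans (Int.ceil_le.2 (hq a).2)
    · rw [not_nonempty_iff_eq_empty, filter_eq_empty_iff] at hne
      have hint : ∀ a, ∃ z : ℤ, x a = z := fun a => not_not.1 (hne (mem_univ a))
      choose z hz using hint
      refine ⟨z, fun a => by rw [hz a]; simp, fun v => ?_⟩
      congr 1
      ext a
      rw [hz a]

end Flow

/-! ### Balanced selections from flow rounding. -/

section Selection

variable {E Θ L κ : Type*} [Fintype E] [Fintype L] [Fintype κ] [DecidableEq Θ] [DecidableEq L]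
  [DecidableEq κ]

/-- The total weight of the elements labelled `l`. -/
def labelWeight (a : E → ℕ) (w : E → L) (l : L) : ℕ := ∑ e with w e = l, a e

theorem sum_labelWeight (a : E → ℕ) (w : E → L) (P : L → Prop) [DecidablePred P] :
    ∑ l with P l, labelWeight a w l = ∑ e with P (w e), a e := by
  simp only [labelWeight]
  rw [← sum_fiberwise_of_maps_to (s := ({e | P (w e)} : Finset E)) (t := ({l | P l} : Finset L))
    (g := w) (by intro e he; simpa using he)]
  refine sum_congr rfl fun l hl => ?_
  rw [filter_filter]
  refine sum_congr (filter_congr fun e _ => ?_) fun _ _ => rfl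
  simp only [mem_filter, mem_univ, true_and] at hl
  constructor
  · rintro rfl; exact ⟨hl, rfl⟩
  · exact fun h => h.2

/-- A set of elements that takes the `p`-th part of the weight of every type and every colour,
at most the rounded up `p`-th part of every label, and that meets the heavy labels of every
colour in which these have weight at least `p`. -/
theorem exists_balanced_selection (a : E → ℕ) (τ : E → Θ) (w : E → L) (γ : L → κ) (p : ℕ)
    (hp : 0 < p) (hap : ∀ e, a e ≤ p) (hτ : ∀ θ, p ∣ ∑ e with τ e = θ, a e)
    (hγ : ∀ j, p ∣ ∑ e with γ (w e) = j, a e) :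
    ∃ T : Finset E, (∀ e ∈ T, 0 < a e) ∧
      (∀ θ, p * #{e ∈ T | τ e = θ} = ∑ e with τ e = θ, a e) ∧
      (∀ l, p * #{e ∈ T | w e = l} < labelWeight a w l + p) ∧
      (∀ j, p * #{e ∈ T | γ (w e) = j} = ∑ e with γ (w e) = j, a e) ∧
      ∀ j, p ≤ ∑ e with γ (w e) = j ∧ 2 ≤ labelWeight a w (w e), a e →
        ∃ e ∈ T, γ (w e) = j ∧ 2 ≤ labelWeight a w (w e) := by
  classical
  have hp' : (0 : ℚ) < p := by exact_mod_cast hp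
  let big : L → Prop := fun l => 2 ≤ labelWeight a w l
  -- The nodes are the types, the labels, a collecting node per colour and a sink per colour. An
  -- element is an arc from its type to its label. Each label has one outgoing arc, to the
  -- collecting node if it is heavy and straight to the sink otherwise; each collecting node has one
  -- arc to its sink.
  let s : E ⊕ L ⊕ κ → Θ ⊕ L ⊕ κ ⊕ κ :=
    Sum.elim (fun e => Sum.inl (τ e))
      (Sum.elim (fun l => Sum.inr (Sum.inl l)) fun j => Sum.inr (Sum.inr (Sum.inl j)))
  let t : E ⊕ L ⊕ κ → Θ ⊕ L ⊕ κ ⊕ κ :=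
    Sum.elim (fun e => Sum.inr (Sum.inl (w e)))
      (Sum.elim (fun l => if big l then Sum.inr (Sum.inr (Sum.inl (γ l)))
        else Sum.inr (Sum.inr (Sum.inr (γ l)))) fun j => Sum.inr (Sum.inr (Sum.inr j)))
  have dτ : ∀ θ (x : E ⊕ L ⊕ κ → ℚ), divergence s t (Sum.inl θ) x
      = ∑ e with τ e = θ, x (Sum.inl e) := by
    intro θ x
    rw [divergence_apply]
    simp only [sum_filter, Fintype.sum_sum_type]
    simp [s, t, ite_eq_iff]
  have dL : ∀ l (x : E ⊕ L ⊕ κ → ℚ), divergence s t (Sum.inr (Sum.inl l)) x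
      = x (Sum.inr (Sum.inl l)) - ∑ e with w e = l, x (Sum.inl e) := by
    intro l x
    rw [divergence_apply]
    simp only [sum_filter, Fintype.sum_sum_type]
    simp [s, t, ite_eq_iff]
  have dD : ∀ j (x : E ⊕ L ⊕ κ → ℚ), divergence s t (Sum.inr (Sum.inr (Sum.inl j))) x
      = x (Sum.inr (Sum.inr j)) - ∑ l with γ l = j ∧ big l, x (Sum.inr (Sum.inl l)) := by
    intro j x
    rw [divergence_apply]
    simp only [sum_filter, Fintype.sum_sum_type]
    simp [s, t, ite_eq_iff, and_comm]
  have dC : ∀ j (x : E ⊕ L ⊕ κ → ℚ), divergence s t (Sum.inr (Sum.inr (Sum.inr j))) x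
      = -(∑ l with γ l = j ∧ ¬ big l, x (Sum.inr (Sum.inl l)) + x (Sum.inr (Sum.inr j))) := by
    intro j x
    rw [divergence_apply]
    simp only [sum_filter, Fintype.sum_sum_type]
    simp [s, t, ite_eq_iff, and_comm]
  -- Each element carries the `p`-th part of its weight and the other arcs what conservation
  -- demands. By `hτ` and `hγ` the divergences at types and sinks are integers.
  let x : E ⊕ L ⊕ κ → ℚ :=
    Sum.elim (fun e => (a e : ℚ) / p)
      (Sum.elim (fun l => (labelWeight a w l : ℚ) / p)
        fun j => ((∑ l with γ l = j ∧ big l, labelWeight a w l : ℕ) : ℚ) / p)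
  have split : ∀ j (f : L → ℚ), ∑ l with γ l = j ∧ ¬ big l, f l + ∑ l with γ l = j ∧ big l, f l
      = ∑ l with γ l = j, f l := by
    intro j f
    rw [← filter_filter, ← filter_filter, add_comm, sum_filter_add_sum_filter_not]
  have xτ : ∀ θ, divergence s t (Sum.inl θ) x = ((∑ e with τ e = θ, a e : ℕ) : ℚ) / p := by
    intro θ
    rw [dτ]
    simp [x, sum_div]
  have xL : ∀ l, divergence s t (Sum.inr (Sum.inl l)) x = 0 := by
    intro l
    rw [dL]
    simp [x, ← sum_div, labelWeight]
  have xD : ∀ j, divergence s t (Sum.inr (Sum.inr (Sum.inl j))) x = 0 := by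
    intro j
    rw [dD]
    simp [x, ← sum_div]
  have xC : ∀ j, divergence s t (Sum.inr (Sum.inr (Sum.inr j))) x
      = -(((∑ e with γ (w e) = j, a e : ℕ) : ℚ) / p) := by
    intro j
    have h := xD j
    rw [dD, sub_eq_zero] at h
    rw [dC, h, split, ← sum_labelWeight a w (fun l => γ l = j)]
    simp [x, ← sum_div]
  obtain ⟨z, hz, hzdiv⟩ := exists_integral_flow s t x (by
    rintro (θ | l | j | j)
    · obtain ⟨q, hq⟩ := hτ θ
      refine ⟨q, ?_⟩
      rw [xτ, hq]
      push_cast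
      field_simp
    · exact ⟨0, by rw [xL]; simp⟩
    · exact ⟨0, by rw [xD]; simp⟩
    · obtain ⟨q, hq⟩ := hγ j
      refine ⟨-q, ?_⟩
      rw [xC, hq]
      push_cast
      field_simp)
  have z01 : ∀ e, z (Sum.inl e) = 0 ∨ z (Sum.inl e) = 1 := by
    intro e
    have h0 : 0 ≤ z (Sum.inl e) :=
      (Int.floor_nonneg.2 (by simp only [x, Sum.elim_inl]; positivity)).trans (hz (Sum.inl e)).1
    have h1 : z (Sum.inl e) ≤ 1 := (hz (Sum.inl e)).2.trans (Int.ceil_le.2 (by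
      simp only [x, Sum.elim_inl, Int.cast_one]
      rw [div_le_one hp']
      exact_mod_cast hap e))
    omega
  let T : Finset E := {e | z (Sum.inl e) = 1}
  have cardT : ∀ (P : E → Prop) [DecidablePred P],
      ((#{e ∈ T | P e} : ℕ) : ℚ) = ∑ e with P e, (z (Sum.inl e) : ℚ) := by
    intro P _
    rw [card_filter, sum_filter (s := univ), sum_filter]
    push_cast
    refine sum_congr rfl fun e _ => ?_
    rcases z01 e with h | h <;> simp [h]
  have zL : ∀ l, (z (Sum.inr (Sum.inl l)) : ℚ) = (#{e ∈ T | w e = l} : ℕ) := by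
    intro l
    have h := hzdiv (Sum.inr (Sum.inl l))
    rw [xL, dL, sub_eq_zero] at h
    rw [cardT, h]
  have cardTL : ∀ (P : L → Prop) [DecidablePred P],
      ((#{e ∈ T | P (w e)} : ℕ) : ℚ) = ∑ l with P l, (z (Sum.inr (Sum.inl l)) : ℚ) := by
    intro P _
    rw [sum_congr rfl fun l _ => zL l, ← Nat.cast_sum]
    congr 1
    rw [card_eq_sum_card_fiberwise (f := w) (t := ({l | P l} : Finset L))
      (by intro e he; simpa using (mem_filter.1 (mem_coe.1 he)).2)]
    refine sum_congr rfl fun l hl => ?_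
    rw [filter_filter]
    congr 1
    refine filter_congr fun e _ => ?_
    simp only [mem_filter, mem_univ, true_and] at hl
    constructor
    · exact fun h => h.2
    · rintro rfl; exact ⟨hl, rfl⟩
  have zD : ∀ j, (z (Sum.inr (Sum.inr j)) : ℚ)
      = ∑ l with γ l = j ∧ big l, (z (Sum.inr (Sum.inl l)) : ℚ) := by
    intro j
    have h := hzdiv (Sum.inr (Sum.inr (Sum.inl j)))
    rw [xD, dD, sub_eq_zero] at h
    exact h
  refine ⟨T, ?_, ?_, ?_, ?_, ?_⟩
  · intro e he
    have he1 : z (Sum.inl e) = 1 := by simpa [T] using he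
    by_contra h
    have h0 : a e = 0 := by omega
    have := (hz (Sum.inl e)).2
    rw [he1] at this
    simp [x, h0] at this
  · intro θ
    have h := hzdiv (Sum.inl θ)
    rw [xτ, dτ, ← cardT, eq_div_iff hp'.ne', mul_comm] at h
    exact_mod_cast h
  · intro l
    have h := (hz (Sum.inr (Sum.inl l))).2
    have h2 := Int.ceil_lt_add_one (x (Sum.inr (Sum.inl l)))
    have h3 : (z (Sum.inr (Sum.inl l)) : ℚ) < x (Sum.inr (Sum.inl l)) + 1 :=
      lt_of_le_of_lt (by exact_mod_cast h) h2
    rw [zL] at h3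
    simp only [x, Sum.elim_inr, Sum.elim_inl] at h3
    rw [div_add_one hp'.ne', lt_div_iff₀ hp', mul_comm] at h3
    exact_mod_cast h3
  · intro j
    have h := hzdiv (Sum.inr (Sum.inr (Sum.inr j)))
    rw [xC, dC, neg_inj, zD, split, ← cardTL, eq_div_iff hp'.ne', mul_comm] at h
    exact_mod_cast h
  · intro j hj
    have h := (hz (Sum.inr (Sum.inr j))).1
    -- The arc collecting the heavy labels of `j` carries at least 1 fractionally, hence also after
    -- rounding.
    have h1 : 1 ≤ z (Sum.inr (Sum.inr j)) := by
      refine le_trans (Int.le_floor.2 ?_) h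
      simp only [x, Sum.elim_inr]
      rw [le_div_iff₀ hp', sum_labelWeight a w (fun l => γ l = j ∧ big l)]
      simp only [Int.cast_one, one_mul]
      exact_mod_cast hj
    have h2 := zD j
    rw [← cardTL (fun l => γ l = j ∧ big l)] at h2
    have h3 : 0 < #{e ∈ T | γ (w e) = j ∧ big (w e)} := by
      have : z (Sum.inr (Sum.inr j)) = (#{e ∈ T | γ (w e) = j ∧ big (w e)} : ℕ) := by
        exact_mod_cast h2
      omega
    obtain ⟨e, he⟩ := card_pos.1 h3
    rw [mem_filter] at he
    exact ⟨e, he.1, he.2⟩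

end Selection

/-! ### Numerical bounds on weights of pieces. -/

section Counting

variable {L : Type*} (B : Finset L) (d z : L → ℕ) (p r : ℕ)

theorem sum_pred_add_card (hd : ∀ l ∈ B, 1 ≤ d l) : ∑ l ∈ B, (d l - 1) + #B = ∑ l ∈ B, d l := by
  rw [card_eq_sum_ones, ← sum_add_distrib]
  exact sum_congr rfl fun l hl => Nat.sub_add_cancel (hd l hl)

/-- Let `e = ∑ (d l - 1)` and `q = ∑ (z l - 1)`, with truncated subtraction. Then `#B = r (p + 1) -
e` and `r - q` labels are touched, so the claim is `p + q ≤ e`. The bound on `#B` gives `p ≤ e` and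
`hz` gives `(p + 1) q ≤ e`; these suffice, whether `q = 0` or `q ≥ 1`. Once the touched labels are
fused, at most `(r - 1) p + 1` remain. -/
theorem card_le_add_card_touched (hd : ∀ l ∈ B, 1 ≤ d l)
    (hz : ∀ l ∈ B, (p + 1) * z l < d l + (p + 1)) (hdsum : ∑ l ∈ B, d l = r * (p + 1))
    (hzsum : ∑ l ∈ B, z l = r) (hr : 0 < r) (hB : #B ≤ (r - 1) * (p + 1) + 1) :
    #B ≤ (r - 1) * p + #{l ∈ B | 0 < z l} := by
  obtain ⟨r, rfl⟩ := Nat.exists_eq_add_of_le' hr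
  have h1 := sum_pred_add_card B d hd
  have h2 : ∑ l ∈ B, (z l - 1) + #{l ∈ B | 0 < z l} = ∑ l ∈ B, z l := by
    rw [card_filter, ← sum_add_distrib]
    refine sum_congr rfl fun l _ => ?_
    split_ifs <;> omega
  have h3 : (p + 1) * ∑ l ∈ B, (z l - 1) ≤ ∑ l ∈ B, (d l - 1) := by
    rw [mul_sum]
    refine sum_le_sum fun l hl => ?_
    have h4 := hz l hl
    have h5 := hd l hl
    rcases Nat.eq_zero_or_pos (z l) with h0 | h0
    · simp [h0]
    · obtain ⟨y, hy⟩ := Nat.exists_eq_add_of_le' h0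
      rw [hy, mul_add] at h4
      rw [hy, Nat.add_sub_cancel]
      omega
  rw [hdsum] at h1
  rw [hzsum] at h2
  generalize ∑ l ∈ B, (d l - 1) = e at *
  generalize ∑ l ∈ B, (z l - 1) = q at *
  generalize #{l ∈ B | 0 < z l} = t at *
  simp only [Nat.add_sub_cancel] at *
  have he : p ≤ e := by nlinarith
  obtain ⟨u, rfl⟩ := Nat.exists_eq_add_of_le he
  have hq : q ≤ u := by
    by_contra hlt
    have : u + 1 ≤ q := by omega
    nlinarith [Nat.mul_le_mul_left (p + 1) this, Nat.zero_le (p * u)]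
  nlinarith

/-- The excess `∑ (d l - 1)` is at least `p` and is carried by the heavy labels alone. As `p > 0`
there is a heavy label, and adding back the number of heavy labels gains at least 1. -/
theorem le_sum_heavy (hd : ∀ l ∈ B, 1 ≤ d l) (hdsum : ∑ l ∈ B, d l = r * (p + 1))
    (hp : 0 < p) (hr : 0 < r) (hB : #B ≤ (r - 1) * (p + 1) + 1) :
    p + 1 ≤ ∑ l ∈ B with 2 ≤ d l, d l := by
  obtain ⟨r, rfl⟩ := Nat.exists_eq_add_of_le' hr
  have h1 := sum_pred_add_card B d hd
  have h2 : ∑ l ∈ B, (d l - 1) = ∑ l ∈ B with 2 ≤ d l, (d l - 1) := by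
    rw [sum_filter]
    refine sum_congr rfl fun l hl => ?_
    split_ifs <;> omega
  have h3 := sum_pred_add_card {l ∈ B | 2 ≤ d l} d fun l hl => hd l (mem_filter.1 hl).1
  simp only [Nat.add_sub_cancel] at *
  have he : p ≤ ∑ l ∈ B with 2 ≤ d l, (d l - 1) := by
    rw [← h2]
    nlinarith
  have h4 : ({l ∈ B | 2 ≤ d l} : Finset L).Nonempty := by
    rw [nonempty_iff_ne_empty]
    intro h0
    rw [h0, sum_empty] at he
    omega
  have := card_pos.2 h4
  omega

end Counting

/-! ### Splitting vertices off the apex. -/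

section Stage

variable {E L κ : Type*}

/-- Two edges of the same colour share an ordinary vertex. -/
def Meets (col : E → κ) (X : E → Finset ℕ) (e f : E) : Prop :=
  col e = col f ∧ ∃ v ∈ X e, v ∈ X f

/-- Two edges are joined by a chain of edges of one colour in which consecutive edges share an
ordinary vertex. -/
def Linked (col : E → κ) (X : E → Finset ℕ) : E → E → Prop := Relation.ReflTransGen (Meets col X)

theorem Meets.symm {col : E → κ} {X : E → Finset ℕ} {e f : E} (h : Meets col X e f) :
    Meets col X f e := by
  obtain ⟨hc, v, h1, h2⟩ := h
  exact ⟨hc.symm, v, h2, h1⟩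

theorem Linked.symm {col : E → κ} {X : E → Finset ℕ} {e f : E} (h : Linked col X e f) :
    Linked col X f e := by
  induction h with
  | refl => exact .refl
  | tail _ h ih => exact .head h.symm ih

theorem Linked.trans {col : E → κ} {X : E → Finset ℕ} {e f g : E} (h : Linked col X e f)
    (h' : Linked col X f g) : Linked col X e g :=
  Relation.ReflTransGen.trans h h'

theorem Linked.col_eq {col : E → κ} {X : E → Finset ℕ} {e f : E} (h : Linked col X e f) :
    col e = col f := by
  induction h with
  | refl => rfl
  | tail _ h ih => exact ih.trans h.1

theorem Linked.mono {col : E → κ} {X X' : E → Finset ℕ} (hX : ∀ e, X e ⊆ X' e) {e f : E}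
    (h : Linked col X e f) : Linked col X' e f :=
  Relation.ReflTransGen.mono (fun _ _ ⟨hc, v, h1, h2⟩ => ⟨hc, v, hX _ h1, hX _ h2⟩) _ _ h

variable [Fintype E] [DecidableEq κ] [DecidableEq L]

/-- The edges `e`, with ordinary vertices `X e ⊆ {0, …, M - 1}` and an apex of multiplicity
`h - |X e|`, form the amalgamation of `lam • K_{M + p}^h` in which `p` vertices are identified with
the apex; the colour classes are regular, and connected through at most `(r - 1) * p + 1` pieces,
labelled by `w`, that all contain the apex. -/
structure IsConnectedAmalgam (lam h r M p : ℕ) (col : E → κ) (X : E → Finset ℕ) (w : E → L) :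
    Prop where
  subset : ∀ e, X e ⊆ range M
  card_le : ∀ e, #(X e) ≤ h
  card_fiber : ∀ Y ⊆ range M, #Y ≤ h → #{e | X e = Y} = lam * p.choose (h - #Y)
  degree : ∀ j, ∀ v < M, #{e | col e = j ∧ v ∈ X e} = r
  degree_apex : ∀ j, ∑ e with col e = j, (h - #(X e)) = r * p
  col_eq : ∀ e f, w e = w f → col e = col f
  linked : ∀ e f, w e = w f → Linked col X e f
  exists_apex : ∀ e, ∃ f, w f = w e ∧ #(X f) < h
  card_labels : ∀ j, #(image w {e | col e = j}) ≤ (r - 1) * p + 1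

theorem sum_image_labelWeight (a : E → ℕ) {col : E → κ} {w : E → L}
    (hcol : ∀ e f, w e = w f → col e = col f) (j : κ) (P : L → Prop) [DecidablePred P] :
    ∑ l ∈ image w {e | col e = j} with P l, labelWeight a w l
      = ∑ e with col e = j ∧ P (w e), a e := by
  rw [← sum_fiberwise_of_maps_to (s := ({e | col e = j ∧ P (w e)} : Finset E))
    (t := ({l ∈ image w {e | col e = j} | P l} : Finset L)) (g := w)]
  · refine sum_congr rfl fun l hl => ?_
    obtain ⟨hl1, hl2⟩ := mem_filter.1 hl
    obtain ⟨e, he, rfl⟩ := mem_image.1 hl1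
    rw [labelWeight, filter_filter]
    refine sum_congr (filter_congr fun f _ => ?_) fun _ _ => rfl
    constructor
    · intro h
      refine ⟨⟨(hcol _ _ h).trans (mem_filter.1 he).2, ?_⟩, h⟩
      rw [h]; exact hl2
    · exact fun h => h.2
  · intro e he
    obtain ⟨h1, h2⟩ := (mem_filter.1 he).2
    exact mem_filter.2 ⟨mem_image_of_mem _ (by simpa using h1), h2⟩

theorem IsConnectedAmalgam.sum_fiber {lam h r M p : ℕ} {col : E → κ} {X : E → Finset ℕ} {w : E → L}
    (S : IsConnectedAmalgam lam h r M p col X w) (Y : Finset ℕ) (hY : Y ⊆ range M) (hYh : #Y ≤ h) :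
    ∑ e with X e = Y, (h - #(X e)) = lam * p.choose (h - #Y) * (h - #Y) := by
  rw [← S.card_fiber Y hY hYh, ← smul_eq_mul, ← sum_const]
  refine sum_congr rfl fun e he => ?_
  rw [(mem_filter.1 he).2]

/-- The fibre of `X e` contains `e`, so its binomial coefficient is nonzero. This bound makes the
rounded flow 0-1 valued on edges. -/
theorem IsConnectedAmalgam.apex_le {lam h r M p : ℕ} {col : E → κ} {X : E → Finset ℕ} {w : E → L}
    (S : IsConnectedAmalgam lam h r M p col X w) (e : E) : h - #(X e) ≤ p := by
  have h1 := S.card_fiber (X e) (S.subset e) (S.card_le e)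
  have h2 : 0 < #{f | X f = X e} := card_pos.2 ⟨e, by simp⟩
  by_contra hlt
  rw [h1, Nat.choose_eq_zero_of_lt (by omega)] at h2
  simp at h2

/-- The edges to be moved when one vertex is split off from the apex. -/
theorem IsConnectedAmalgam.exists_selection [Fintype L] [Fintype κ] [Nonempty κ]
    {lam h r M p : ℕ} {col : E → κ}
    {X : E → Finset ℕ} {w : E → L} (S : IsConnectedAmalgam lam h r M (p + 1) col X w) (hp : 0 < p)
    (hr : 0 < r) :
    ∃ T : Finset E, (∀ e ∈ T, #(X e) < h) ∧
      (∀ Y ⊆ range M, #Y ≤ h →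
        (p + 1) * #{e ∈ T | X e = Y} = lam * (p + 1).choose (h - #Y) * (h - #Y)) ∧
      (∀ l, (p + 1) * #{e ∈ T | w e = l} < labelWeight (fun e => h - #(X e)) w l + (p + 1)) ∧
      (∀ j, #{e ∈ T | col e = j} = r) ∧
      ∀ j, ∃ e ∈ T, col e = j ∧ 2 ≤ labelWeight (fun e => h - #(X e)) w (w e) := by
  -- Labels outside the range of `w` have weight 0, so their colour is immaterial.
  let γ : L → κ := Function.extend w col fun _ => Classical.arbitrary κ
  have hγ : ∀ e, γ (w e) = col e :=
    Function.FactorsThrough.extend_apply (fun _ _ h => S.col_eq _ _ h) _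
  obtain ⟨T, hT1, hT2, hT3, hT4, hT5⟩ :=
    exists_balanced_selection (fun e => h - #(X e)) X w γ (p + 1)
    p.succ_pos S.apex_le (fun Y => by
      by_cases hY : ∃ e, X e = Y
      · obtain ⟨e, rfl⟩ := hY
        rw [S.sum_fiber _ (S.subset e) (S.card_le e)]
        rcases Nat.eq_zero_or_pos (h - #(X e)) with h0 | h0
        · simp [h0]
        · obtain ⟨i, hi⟩ := Nat.exists_eq_add_of_le' h0
          -- Divisibility comes from `(p + 1).choose (i + 1) * (i + 1) = (p + 1) * p.choose i`.
          rw [hi, mul_assoc, ← Nat.add_one_mul_choose_eq]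
          exact dvd_mul_of_dvd_right (dvd_mul_right _ _) _
      · push Not at hY
        rw [filter_false_of_mem fun e _ => hY e, sum_empty]
        exact dvd_zero _) (fun j => by
      simp only [hγ]
      rw [S.degree_apex]
      exact dvd_mul_left _ _)
  simp only [hγ] at hT4 hT5
  refine ⟨T, fun e he => by have := hT1 e he; omega, fun Y hY hYh => ?_, hT3, fun j => ?_,
    fun j => hT5 j ?_⟩
  · rw [hT2, S.sum_fiber Y hY hYh]
  · have := hT4 j
    rw [S.degree_apex, mul_comm] at this
    exact Nat.eq_of_mul_eq_mul_right p.succ_pos this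
  · rw [← sum_image_labelWeight _ S.col_eq j (fun l => 2 ≤ labelWeight (fun e => h - #(X e)) w l)]
    refine le_sum_heavy _ _ p r ?_ ?_ hp hr (S.card_labels j)
    · intro l hl
      obtain ⟨e, _, rfl⟩ := mem_image.1 hl
      obtain ⟨f, hf, hfh⟩ := S.exists_apex e
      refine le_trans (by omega : 1 ≤ h - #(X f))
        (single_le_sum (f := fun e => h - #(X e)) (fun _ _ => Nat.zero_le _) ?_)
      simpa using hf
    · have := sum_image_labelWeight (fun e => h - #(X e)) S.col_eq j (fun _ => True)
      simp only [filter_true, and_true] at this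
      rw [this, S.degree_apex]

/-- One vertex can be split off from the apex. -/
theorem IsConnectedAmalgam.exists_split [Fintype L] [Fintype κ] [Nonempty κ]
    {lam h r M p : ℕ} {col : E → κ}
    {X : E → Finset ℕ} {w : E → L} (S : IsConnectedAmalgam lam h r M (p + 1) col X w) (hp : 0 < p)
    (hr : 0 < r) :
    ∃ (X' : E → Finset ℕ) (w' : E → L), IsConnectedAmalgam lam h r (M + 1) p col X' w' ∧
      ∀ e, #(X e) = h → X' e = X e := by
  classical
  obtain ⟨T, hT1, hT2, hT3, hT4, hT5⟩ := S.exists_selection hp hr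
  choose rep hrepT hrepc hrepw using hT5
  have hM : ∀ e, M ∉ X e := fun e he => by simpa using S.subset e he
  let X' : E → Finset ℕ := fun e => if e ∈ T then insert M (X e) else X e
  let Touched : E → Prop := fun e => ∃ f ∈ T, w f = w e
  -- The touched pieces of a colour are fused under the label of a heavy touched piece. That label
  -- is itself touched, so it cannot clash with an untouched one.
  let w' : E → L := fun e => if Touched e then w (rep (col e)) else w e
  have hX'T : ∀ e, e ∈ T → X' e = insert M (X e) := fun e he => if_pos he
  have hX'n : ∀ e, e ∉ T → X' e = X e := fun e he => if_neg he
  have hMX' : ∀ e, M ∈ X' e ↔ e ∈ T := by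
    intro e
    by_cases he : e ∈ T
    · simp [hX'T e he, he]
    · simp [hX'n e he, he, hM e]
  have hXX' : ∀ e, X e ⊆ X' e := by
    intro e
    by_cases he : e ∈ T
    · rw [hX'T e he]; exact subset_insert _ _
    · rw [hX'n e he]
  have herase : ∀ e, (X' e).erase M = X e := by
    intro e
    by_cases he : e ∈ T
    · rw [hX'T e he, erase_insert (hM e)]
    · rw [hX'n e he, erase_eq_of_notMem (hM e)]
  have hcard : ∀ e, #(X' e) = #(X e) + if e ∈ T then 1 else 0 := by
    intro e
    by_cases he : e ∈ T
    · rw [hX'T e he, card_insert_of_notMem (hM e), if_pos he]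
    · rw [hX'n e he, if_neg he, add_zero]
  have hcardle : ∀ e, #(X' e) ≤ h := by
    intro e
    rw [hcard]
    have := S.card_le e
    split_ifs with he
    · exact hT1 e he
    · exact this
  have hw't : ∀ e, Touched e → w' e = w (rep (col e)) := fun e he => if_pos he
  have hw'n : ∀ e, ¬ Touched e → w' e = w e := fun e he => if_neg he
  have hrep : ∀ j e, w (rep j) = w e → Touched e := fun j e he => ⟨rep j, hrepT j, he⟩
  have hww : ∀ e f, w' e = w' f →
      (Touched e ∧ Touched f ∧ col e = col f) ∨ (¬ Touched e ∧ ¬ Touched f ∧ w e = w f) := by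
    intro e f hef
    by_cases he : Touched e <;> by_cases hf : Touched f
    · rw [hw't e he, hw't f hf] at hef
      refine Or.inl ⟨he, hf, ?_⟩
      rw [← hrepc (col e), ← hrepc (col f)]
      exact S.col_eq _ _ hef
    · rw [hw't e he, hw'n f hf] at hef
      exact absurd (hrep _ _ hef) hf
    · rw [hw'n e he, hw't f hf] at hef
      exact absurd (hrep _ _ hef.symm) he
    · rw [hw'n e he, hw'n f hf] at hef
      exact Or.inr ⟨he, hf, hef⟩
  have hpos : ∀ e, 1 ≤ labelWeight (fun e => h - #(X e)) w (w e) := by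
    intro e
    obtain ⟨f, hf, hfh⟩ := S.exists_apex e
    refine le_trans (by omega : 1 ≤ h - #(X f))
      (single_le_sum (f := fun e => h - #(X e)) (fun _ _ => Nat.zero_le _) ?_)
    simpa using hf
  refine ⟨X', w', ⟨?_, hcardle, ?_, ?_, ?_, ?_, ?_, ?_, ?_⟩, ?_⟩
  · intro e v hv
    by_cases hvM : v = M
    · simp [hvM]
    · have : v ∈ X e := by rw [← herase e]; exact mem_erase.2 ⟨hvM, hv⟩
      have := mem_range.1 (S.subset e this)
      exact mem_range.2 (by omega)
  · intro Y hY hYh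
    by_cases hMY : M ∈ Y
    · have hc : #(Y.erase M) + 1 = #Y := card_erase_add_one hMY
      have hsub : Y.erase M ⊆ range M := by
        intro v hv
        rw [mem_erase] at hv
        have := mem_range.1 (hY hv.2)
        exact mem_range.2 (by omega)
      have h1 := hT2 (Y.erase M) hsub (by omega)
      have h2 : h - #(Y.erase M) = h - #Y + 1 := by omega
      rw [h2, mul_assoc, ← Nat.add_one_mul_choose_eq, mul_left_comm] at h1
      rw [← Nat.eq_of_mul_eq_mul_left p.succ_pos h1]
      congr 1
      ext e
      simp only [mem_filter, mem_univ, true_and]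
      constructor
      · rintro rfl
        exact ⟨(hMX' e).1 hMY, (herase e).symm⟩
      · rintro ⟨he, hXe⟩
        rw [hX'T e he, hXe, insert_erase hMY]
    · have hsub : Y ⊆ range M := by
        intro v hv
        have := mem_range.1 (hY hv)
        have : v ≠ M := fun h => hMY (h ▸ hv)
        exact mem_range.2 (by omega)
      have h1 := hT2 Y hsub hYh
      have h2 := S.card_fiber Y hsub hYh
      have h3 : #{e | X' e = Y} + #{e ∈ T | X e = Y} = #{e | X e = Y} := by
        rw [← card_union_of_disjoint]
        · congr 1
          ext e
          simp only [mem_union, mem_filter, mem_univ, true_and]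
          by_cases he : e ∈ T
          · have : X' e ≠ Y := fun hh => hMY (hh ▸ (hMX' e).2 he)
            simp [he, this]
          · simp [he, hX'n e he]
        · rw [disjoint_left]
          intro e he he'
          simp only [mem_filter, mem_univ, true_and] at he he'
          exact hMY (he ▸ (hMX' e).2 he'.1)
      rcases Nat.eq_zero_or_pos (h - #Y) with h0 | h0
      · rw [h0, mul_zero] at h1
        have h4 : #{e ∈ T | X e = Y} = 0 := (Nat.mul_eq_zero.1 h1).resolve_left (by omega)
        rw [h0, Nat.choose_zero_right] at h2 ⊢
        omega
      · obtain ⟨i, hi⟩ : ∃ i, h - #Y = i + 1 := Nat.exists_eq_add_of_le' h0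
        rw [hi, mul_assoc, ← Nat.add_one_mul_choose_eq, mul_left_comm] at h1
        have h4 := Nat.eq_of_mul_eq_mul_left p.succ_pos h1
        -- Pascal's rule: `lam * p.choose i` edges of type `Y` are taken and `lam * p.choose (i +
        -- 1)` stay.
        rw [hi, Nat.choose_succ_succ', mul_add] at h2
        rw [hi]
        omega
  · intro j v hv
    rcases Nat.lt_succ_iff_lt_or_eq.1 hv with hlt | rfl
    · rw [← S.degree j v hlt]
      congr 1
      refine filter_congr fun e _ => ?_
      rw [← herase e, mem_erase]
      constructor
      · exact fun hh => ⟨hh.1, by omega, hh.2⟩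
      · exact fun hh => ⟨hh.1, hh.2.2⟩
    · rw [← hT4 j]
      congr 1
      ext e
      simp [hMX', and_comm]
  · intro j
    have h1 := S.degree_apex j
    have h2 : ∑ e with col e = j, (h - #(X' e)) + #{e ∈ T | col e = j}
        = ∑ e with col e = j, (h - #(X e)) := by
      have h3 : #{e ∈ T | col e = j} = ∑ e with col e = j, if e ∈ T then 1 else 0 := by
        rw [← card_filter, filter_filter]
        congr 1
        ext e
        simp [and_comm]
      rw [h3, ← sum_add_distrib]
      refine sum_congr rfl fun e _ => ?_
      rw [hcard]
      split_ifs with he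
      · have := hT1 e he
        omega
      · omega
    rw [h1, hT4 j, mul_add] at h2
    omega
  · intro e f hef
    rcases hww e f hef with hh | hh
    · exact hh.2.2
    · exact S.col_eq _ _ hh.2.2
  · intro e f hef
    rcases hww e f hef with ⟨⟨g, hg, hge⟩, ⟨g', hg', hgf⟩, hc⟩ | hh
    · have h1 := (S.linked e g hge.symm).mono hXX'
      have h2 := (S.linked g' f hgf).mono hXX'
      refine h1.trans (Linked.trans (Relation.ReflTransGen.single ⟨?_, M, ?_, ?_⟩) h2)
      · rw [← h1.col_eq, h2.col_eq, hc]
      · exact (hMX' g).2 hg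
      · exact (hMX' g').2 hg'
    · exact (S.linked e f hh.2.2).mono hXX'
  · intro e
    by_cases he : Touched e
    -- If the fused piece had lost the apex, every apex occurrence in the representative's piece
    -- would have been taken. With its weight `W ≥ 2` this means `(p + 1) W < W + (p + 1)`,
    -- impossible for `p ≥ 1`. A piece of weight 1 would not do.
    · by_contra hno
      push Not at hno
      have h1 := hT3 (w (rep (col e)))
      have h2 := hrepw (col e)
      have h3 : labelWeight (fun e => h - #(X e)) w (w (rep (col e)))
          = #{f ∈ T | w f = w (rep (col e))} := by
        have h4 : #{f ∈ T | w f = w (rep (col e))}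
            = ∑ f with w f = w (rep (col e)), if f ∈ T then 1 else 0 := by
          rw [← card_filter, filter_filter]
          congr 1
          ext f
          simp [and_comm]
        rw [h4, labelWeight]
        refine sum_congr rfl fun f hf => ?_
        have hf' : w f = w (rep (col e)) := (mem_filter.1 hf).2
        have hft : Touched f := hrep _ _ hf'.symm
        have hcf : col f = col e := (S.col_eq _ _ hf').trans (hrepc _)
        have h5 := hno f (by rw [hw't f hft, hw't e he, hcf])
        have h6 := hcardle f
        rw [hcard] at h5 h6
        split_ifs at h5 h6 ⊢ <;> omega
      rw [← h3] at h1
      nlinarith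
    · obtain ⟨f, hf, hfh⟩ := S.exists_apex e
      have hft : ¬ Touched f := fun ⟨g, hg, hgf⟩ => he ⟨g, hg, hgf.trans hf⟩
      refine ⟨f, by rw [hw'n f hft, hw'n e he, hf], ?_⟩
      rw [hX'n f fun hfT => hft ⟨f, hfT, rfl⟩]
      exact hfh
  · intro j
    let B : Finset L := image w {e | col e = j}
    let z : L → ℕ := fun l => #{e ∈ T | w e = l}
    have h1 := card_le_add_card_touched B (labelWeight (fun e => h - #(X e)) w) z p r
      (by
        intro l hl
        obtain ⟨e, _, rfl⟩ := mem_image.1 hl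
        exact hpos e) (fun l _ => hT3 l)
      (by
        have := sum_image_labelWeight (fun e => h - #(X e)) S.col_eq j (fun _ => True)
        simp only [filter_true, and_true] at this
        rw [this, S.degree_apex])
      (by
        rw [← hT4 j, card_eq_sum_card_fiberwise (f := w) (t := B)]
        · refine sum_congr rfl fun l hl => ?_
          obtain ⟨e, he, rfl⟩ := mem_image.1 hl
          rw [filter_filter]
          simp only [z]
          congr 1
          refine filter_congr fun f _ => ?_
          constructor
          · exact fun hh => ⟨(S.col_eq _ _ hh).trans (mem_filter.1 he).2, hh⟩
          · exact fun hh => hh.2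
        · intro e he
          have := (mem_filter.1 (mem_coe.1 he)).2
          exact mem_coe.2 (mem_image_of_mem _ (by simpa using this)))
      hr (S.card_labels j)
    -- What remains is the fused label and the untouched ones.
    have h2 : image w' {e | col e = j} ⊆ insert (w (rep j)) {l ∈ B | ¬ 0 < z l} := by
      intro l hl
      obtain ⟨e, he, rfl⟩ := mem_image.1 hl
      have hej : col e = j := (mem_filter.1 he).2
      by_cases het : Touched e
      · rw [hw't e het, hej]
        exact mem_insert_self _ _
      · rw [hw'n e het]
        refine mem_insert_of_mem (mem_filter.2 ⟨mem_image_of_mem _ he, fun hz => ?_⟩)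
        obtain ⟨f, hf⟩ := card_pos.1 hz
        exact het ⟨f, (mem_filter.1 hf).1, (mem_filter.1 hf).2⟩
    have h3 := (card_le_card h2).trans (card_insert_le _ _)
    have h4 := card_filter_add_card_filter_not (s := B) (fun l => 0 < z l)
    omega
  · intro e he
    exact hX'n e fun heT => (hT1 e heT).ne he

/-- All vertices identified with the apex can be split off. -/
theorem IsConnectedAmalgam.exists_detachment [Fintype L] [Fintype κ] [Nonempty κ]
    {lam h r p : ℕ} {col : E → κ} (hr : 0 < r) :
    ∀ {M : ℕ} {X : E → Finset ℕ} {w : E → L}, IsConnectedAmalgam lam h r M (p + 1) col X w →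
    ∃ Z : E → Finset ℕ, (∀ e, Z e ⊆ range (M + (p + 1))) ∧ (∀ e, #(Z e) = h) ∧
      (∀ Y ⊆ range (M + (p + 1)), #Y = h → #{e | Z e = Y} = lam) ∧
      (∀ j, ∀ v < M + (p + 1), #{e | col e = j ∧ v ∈ Z e} = r) ∧
      (∀ e f, col e = col f → Linked col Z e f) ∧ ∀ e, #(X e) = h → Z e = X e := by
  induction p with
  | succ p ih =>
    intro M X w S
    obtain ⟨X', w', S', hX'⟩ := S.exists_split p.succ_pos hr
    obtain ⟨Z, h1, h2, h3, h4, h5, h6⟩ := ih S'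
    rw [show M + 1 + (p + 1) = M + (p + 1 + 1) by ring] at h1 h3 h4
    refine ⟨Z, h1, h2, h3, h4, h5, fun e he => ?_⟩
    rw [← hX' e he, h6 e (by rw [hX' e he, he])]
  | zero =>
    intro M X w S
    have hM : ∀ e, M ∉ X e := fun e he => by simpa using S.subset e he
    -- An apex standing for one vertex has multiplicity at most 1 in every edge and is simply
    -- renamed `M`.
    let Z : E → Finset ℕ := fun e => if #(X e) < h then insert M (X e) else X e
    have hMZ : ∀ e, M ∈ Z e ↔ #(X e) < h := by
      intro e
      simp only [Z]
      split_ifs with he <;> simp [he, hM e]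
    have herase : ∀ e, (Z e).erase M = X e := by
      intro e
      simp only [Z]
      split_ifs with he
      · rw [erase_insert (hM e)]
      · rw [erase_eq_of_notMem (hM e)]
    have hXZ : ∀ e, X e ⊆ Z e := fun e => by rw [← herase e]; exact erase_subset _ _
    have hcardZ : ∀ e, #(Z e) = h := by
      intro e
      have h1 := S.apex_le e
      have h2 := S.card_le e
      simp only [Z]
      split_ifs with he
      · rw [card_insert_of_notMem (hM e)]
        omega
      · omega
    refine ⟨Z, ?_, hcardZ, ?_, ?_, ?_, ?_⟩
    · intro e v hv
      by_cases hvM : v = M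
      · simp [hvM]
      · have : v ∈ X e := by rw [← herase e]; exact mem_erase.2 ⟨hvM, hv⟩
        have := mem_range.1 (S.subset e this)
        exact mem_range.2 (by omega)
    · intro Y hY hYh
      have hsub : Y.erase M ⊆ range M := by
        intro v hv
        rw [mem_erase] at hv
        have := mem_range.1 (hY hv.2)
        exact mem_range.2 (by omega)
      have hle : #(Y.erase M) ≤ #Y := card_le_card (erase_subset _ _)
      have h1 := S.card_fiber (Y.erase M) hsub (by omega)
      have h2 : Nat.choose (0 + 1) (h - #(Y.erase M)) = 1 := by
        have := pred_card_le_card_erase (s := Y) (a := M)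
        have h3 : h - #(Y.erase M) = 0 ∨ h - #(Y.erase M) = 1 := by omega
        rcases h3 with h3 | h3 <;> simp [h3]
      rw [h2, mul_one] at h1
      rw [← h1]
      congr 1
      refine filter_congr fun e _ => ?_
      constructor
      · rintro rfl
        exact (herase e).symm
      · intro hXe
        have h3 := hcardZ e
        by_cases hMY : M ∈ Y
        · have h4 := card_erase_add_one hMY
          have h5 : #(X e) < h := by rw [hXe]; omega
          simp only [Z]
          rw [if_pos h5, hXe, insert_erase hMY]
        · rw [erase_eq_of_notMem hMY] at hXe
          have h5 : ¬ #(X e) < h := by rw [hXe]; omega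
          simp only [Z]
          rw [if_neg h5, hXe]
    · intro j v hv
      rcases Nat.lt_succ_iff_lt_or_eq.1 (show v < M + 1 by omega) with hlt | rfl
      · rw [← S.degree j v hlt]
        congr 1
        refine filter_congr fun e _ => ?_
        rw [← herase e, mem_erase]
        constructor
        · exact fun hh => ⟨hh.1, by omega, hh.2⟩
        · exact fun hh => ⟨hh.1, hh.2.2⟩
      · have h1 := S.degree_apex j
        rw [zero_add, mul_one] at h1
        rw [← h1, ← filter_filter, card_filter]
        refine sum_congr rfl fun e _ => ?_
        have h1 := S.apex_le e
        simp only [hMZ]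
        split_ifs <;> omega
    · intro e f hef
      -- Every piece contains the apex, so `M` joins all pieces of a colour.
      obtain ⟨e', he', heh⟩ := S.exists_apex e
      obtain ⟨f', hf', hfh⟩ := S.exists_apex f
      have h1 := (S.linked e e' he'.symm).mono hXZ
      have h2 := (S.linked f' f hf').mono hXZ
      refine h1.trans (Linked.trans (Relation.ReflTransGen.single ⟨?_, M, ?_, ?_⟩) h2)
      · rw [← h1.col_eq, h2.col_eq, hef]
      · exact (hMZ e').2 heh
      · exact (hMZ f').2 hfh
    · intro e he
      simp only [Z]
      rw [if_neg (by omega)]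

end Stage

/-! ### Link classes and walks. -/

section Links

variable {V E κ : Type*}

/-- The edges linked to `e`. -/
noncomputable def linkClass [Fintype E] (col : E → κ) (X : E → Finset ℕ) (e : E) : Finset E :=
  open Classical in {f | Linked col X e f}

theorem mem_linkClass [Fintype E] {col : E → κ} {X : E → Finset ℕ} {e f : E} :
    f ∈ linkClass col X e ↔ Linked col X e f := by
  classical
  simp [linkClass]

theorem linkClass_eq_iff [Fintype E] {col : E → κ} {X : E → Finset ℕ} {e f : E} :
    linkClass col X e = linkClass col X f ↔ Linked col X e f := by
  constructor
  · intro h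
    rw [← mem_linkClass, h, mem_linkClass]
    exact .refl
  · intro h
    ext g
    rw [mem_linkClass, mem_linkClass]
    exact ⟨h.symm.trans, h.trans⟩

theorem Linked.reflTransGen {G : MultiHypergraph V E} {col : E → κ} {X : E → Finset ℕ}
    (hG : ∀ e f, Meets col X e f → ∃ v ∈ G.ends e, v ∈ G.ends f) {P : Finset E} {e f : E}
    (h : Linked col X e f) (hP : ∀ g, Linked col X e g → g ∈ P) {u v : V} (hu : u ∈ G.ends e)
    (hv : v ∈ G.ends f) :
    Relation.ReflTransGen (fun x y => ∃ g ∈ P, x ∈ G.ends g ∧ y ∈ G.ends g) u v := by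
  induction h generalizing v with
  | refl => exact .single ⟨e, hP e .refl, hu, hv⟩
  | tail h1 h2 ih =>
    obtain ⟨x, hx, hx'⟩ := hG _ _ h2
    exact (ih hx).tail ⟨_, hP _ (Relation.ReflTransGen.tail h1 h2), hx', hv⟩

theorem linked_of_reflTransGen {G : MultiHypergraph V E} {col : E → κ} {X : E → Finset ℕ}
    (hG : ∀ e f v, col e = col f → v ∈ G.ends e → v ∈ G.ends f → Meets col X e f)
    {P : Finset E} {j : κ} (hP : ∀ e ∈ P, col e = j) {u v : V}
    (h : Relation.ReflTransGen (fun x y => ∃ g ∈ P, x ∈ G.ends g ∧ y ∈ G.ends g) u v) {e f : E}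
    (he : col e = j) (hf : col f = j) (hu : u ∈ G.ends e) (hv : v ∈ G.ends f) :
    Linked col X e f := by
  induction h generalizing f with
  | refl => exact .single (hG e f u (he.trans hf.symm) hu hv)
  | tail _ h2 ih =>
    obtain ⟨g, hg, hx, hy⟩ := h2
    exact (ih (hP g hg) hx).tail (hG g f _ ((hP g hg).trans hf.symm) hy hv)

end Links

/-! ### Wings are link classes. -/

section Wings

/-- Connectedness excludes isolated vertices other than `a`, so a wing is determined by its edges.
-/
theorem Sub.IsWing.mem_verts_iff {V E : Type*} [DecidableEq V] [DecidableEq E]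
    {G : MultiHypergraph V E} {C W : G.Sub} {a : V} (hW : C.IsWing a W) (v : V) :
    v ∈ W.verts ↔ v = a ∨ ∃ e ∈ W.edges, v ∈ G.ends e := by
  constructor
  · intro hv
    rcases (hW.connected.2 a hW.mem_verts v hv).cases_tail with h | ⟨_, _, e, he, _, hve⟩
    · exact Or.inl h
    · exact Or.inr ⟨e, he, hve⟩
  · rintro (rfl | ⟨e, he, hv⟩)
    · exact hW.mem_verts
    · exact W.ends_mem e he v hv

variable {E : Type*} [Fintype E] {m k : ℕ}
  {G : MultiHypergraph (Option (Fin m)) E} {col : E → Fin k} {X : E → Finset ℕ} {j : Fin k}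

/-- Follow the walk up to its first visit to the apex: until then consecutive edges share ordinary
vertices. Hence connectedness puts the apex into every link class. -/
theorem exists_linked_apex
    (hX : ∀ e (v : Fin m), some v ∈ G.ends e ↔ (v : ℕ) ∈ X e)
    {u : Option (Fin m)}
    (h : Relation.ReflTransGen (fun x y => ∃ g ∈ (G.colorClass col j).edges,
      x ∈ G.ends g ∧ y ∈ G.ends g) u none) {e : E} (he : col e = j) (hu : u ∈ G.ends e) :
    ∃ f, Linked col X e f ∧ none ∈ G.ends f := by
  induction h using Relation.ReflTransGen.head_induction_on generalizing e with
  | refl => exact ⟨e, .refl, hu⟩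
  | head h1 h2 ih =>
    rename_i a b
    clear h2
    obtain ⟨g, hg, ha, hb⟩ := h1
    have hgj : col g = j := by simpa [colorClass] using hg
    cases a with
    | none => exact ⟨e, .refl, hu⟩
    | some v =>
      obtain ⟨f, hf, hf'⟩ := ih hgj hb
      exact ⟨f, .head ⟨he.trans hgj.symm, v, (hX e v).1 hu, (hX g v).1 ha⟩ hf, hf'⟩

variable [DecidableEq E]

/-- Closedness spreads membership along links. If an edge were left over, the link class and the
remaining edges would share only the apex, which would then be a cut vertex. -/
theorem Sub.IsWing.edges_eq_linkClass
    (hX : ∀ e (v : Fin m), some v ∈ G.ends e ↔ (v : ℕ) ∈ X e) (hXm : ∀ e, X e ⊆ range m)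
    {W : G.Sub} (hW : (G.colorClass col j).IsWing none W) {e : E} (he : e ∈ W.edges) :
    W.edges = linkClass col X e := by
  have hcol : ∀ f, f ∈ (G.colorClass col j).edges ↔ col f = j := by simp [colorClass]
  have hsub : linkClass col X e ⊆ W.edges := by
    intro f hf
    rw [mem_linkClass] at hf
    induction hf with
    | refl => exact he
    | tail h1 h2 ih =>
      rename_i f g
      clear h1
      obtain ⟨hc, v, hv, hv'⟩ := h2
      have hvm : v < m := mem_range.1 (hXm _ hv)
      by_contra hg
      refine hW.closed g ?_ hg (some ⟨v, hvm⟩) ?_ (Option.some_ne_none _) ((hX _ _).2 hv')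
      · rw [hcol, ← hc, ← hcol]
        exact hW.edges_subset ih
      · exact W.ends_mem f ih _ ((hX _ _).2 hv)
  refine subset_antisymm ?_ hsub
  by_contra hne
  refine hW.not_isCutVertex ?_
  let part : Finset E → Finset (Option (Fin m)) :=
    fun P => insert none ({v | ∃ f ∈ P, v ∈ G.ends f} : Finset (Option (Fin m)))
  have hpart : ∀ P v, v ∈ part P ↔ v = none ∨ ∃ f ∈ P, v ∈ G.ends f := by simp [part]
  refine ⟨⟨part (linkClass col X e), linkClass col X e, fun f hf v hv =>
      (hpart _ _).2 (Or.inr ⟨f, hf, hv⟩)⟩,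
    ⟨part (W.edges \ linkClass col X e), W.edges \ linkClass col X e, fun f hf v hv =>
      (hpart _ _).2 (Or.inr ⟨f, hf, hv⟩)⟩, ⟨e, mem_linkClass.2 .refl⟩,
    sdiff_nonempty.2 hne, ?_, union_sdiff_of_subset hsub, ?_, inter_sdiff_self _ _⟩
  · ext v
    simp only [mem_union, hpart, hW.mem_verts_iff]
    constructor
    · rintro ((h | ⟨f, hf, hv⟩) | (h | ⟨f, hf, hv⟩))
      · exact Or.inl h
      · exact Or.inr ⟨f, hsub hf, hv⟩
      · exact Or.inl h
      · exact Or.inr ⟨f, (mem_sdiff.1 hf).1, hv⟩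
    · rintro (h | ⟨f, hf, hv⟩)
      · exact Or.inl (Or.inl h)
      · by_cases hfe : f ∈ linkClass col X e
        · exact Or.inl (Or.inr ⟨f, hfe, hv⟩)
        · exact Or.inr (Or.inr ⟨f, mem_sdiff.2 ⟨hf, hfe⟩, hv⟩)
  · ext v
    simp only [mem_inter, hpart, mem_singleton]
    constructor
    · rintro ⟨h | ⟨f, hf, hv⟩, h' | ⟨g, hg, hv'⟩⟩
      · exact h
      · exact h
      · exact h'
      · cases v with
        | none => rfl
        | some v =>
          obtain ⟨hg1, hg2⟩ := mem_sdiff.1 hg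
          refine absurd (mem_linkClass.2 ?_) hg2
          have h1 := (hcol _).1 (hW.edges_subset (hsub hf))
          have h2 := (hcol _).1 (hW.edges_subset hg1)
          exact (mem_linkClass.1 hf).tail
            ⟨h1.trans h2.symm, v, (hX _ _).1 hv, (hX _ _).1 hv'⟩
    · exact fun h => ⟨Or.inl h, Or.inl h⟩

/-- A separation at the apex would put two linked edges into different parts, and somewhere along
the chain an ordinary vertex would lie in both. -/
theorem exists_isWing_linkClass
    (hX : ∀ e (v : Fin m), some v ∈ G.ends e ↔ (v : ℕ) ∈ X e) (hXm : ∀ e, X e ⊆ range m)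
    {e : E} (he : col e = j) (hapex : ∃ f, Linked col X e f ∧ none ∈ G.ends f) :
    ∃ W, (G.colorClass col j).IsWing none W ∧ W.edges = linkClass col X e := by
  have hcol : ∀ f, f ∈ (G.colorClass col j).edges ↔ col f = j := by simp [colorClass]
  have hmeet : ∀ e f, Meets col X e f → ∃ v ∈ G.ends e, v ∈ G.ends f := by
    rintro e f ⟨_, v, hv, hv'⟩
    have hvm : v < m := mem_range.1 (hXm _ hv)
    exact ⟨some ⟨v, hvm⟩, (hX _ _).2 hv, (hX _ _).2 hv'⟩
  obtain ⟨f₀, hf₀, hapex⟩ := hapex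
  let W : G.Sub := ⟨{v | ∃ f ∈ linkClass col X e, v ∈ G.ends f}, linkClass col X e,
    fun f hf v hv => by simpa using ⟨f, hf, hv⟩⟩
  have hWv : ∀ v, v ∈ W.verts ↔ ∃ f ∈ linkClass col X e, v ∈ G.ends f := by simp [W]
  have hnone : none ∈ W.verts := (hWv _).2 ⟨f₀, mem_linkClass.2 hf₀, hapex⟩
  refine ⟨W, ⟨subset_univ _, ?_, hnone, ⟨e, mem_linkClass.2 .refl⟩, ⟨⟨none, hnone⟩, ?_⟩, ?_, ?_⟩,
    rfl⟩
  · intro f hf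
    rw [hcol, ← (mem_linkClass.1 hf).col_eq, he]
  · intro u hu v hv
    obtain ⟨f, hf, huf⟩ := (hWv u).1 hu
    obtain ⟨g, hg, hvg⟩ := (hWv v).1 hv
    rw [mem_linkClass] at hf hg
    exact (hf.symm.trans hg).reflTransGen hmeet (fun g' hg' => mem_linkClass.2 (hf.trans hg'))
      huf hvg
  · rintro ⟨I, J, ⟨e₁, he₁⟩, ⟨e₂, he₂⟩, -, hE, hv, hd⟩
    have hmem : ∀ f, Linked col X e₁ f → f ∈ I.edges := by
      have h1 : Linked col X e e₁ := by
        rw [← mem_linkClass]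
        exact hE.subset (mem_union_left _ he₁)
      intro f hf
      induction hf with
      | refl => exact he₁
      | tail h2 h3 ih =>
        rename_i f g
        have hg : g ∈ I.edges ∪ J.edges := by
          rw [hE]
          exact mem_linkClass.2 ((h1.trans h2).tail h3)
        rcases mem_union.1 hg with hg | hg
        · exact hg
        · obtain ⟨_, v, hvf, hvg⟩ := h3
          have hvm : v < m := mem_range.1 (hXm _ hvf)
          have : some ⟨v, hvm⟩ ∈ I.verts ∩ J.verts :=
            mem_inter.2 ⟨I.ends_mem f ih _ ((hX _ _).2 hvf), J.ends_mem g hg _ ((hX _ _).2 hvg)⟩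
          rw [hv] at this
          simp at this
    have h1 : Linked col X e e₁ := by
      rw [← mem_linkClass]
      exact hE.subset (mem_union_left _ he₁)
    have h2 : Linked col X e e₂ := by
      rw [← mem_linkClass]
      exact hE.subset (mem_union_right _ he₂)
    have : e₂ ∈ I.edges ∩ J.edges := mem_inter.2 ⟨hmem e₂ (h1.symm.trans h2), he₂⟩
    rw [hd] at this
    simp at this
  · intro f hf hfW v hv hvn hvf
    obtain ⟨g, hg, hvg⟩ := (hWv v).1 hv
    obtain ⟨v, rfl⟩ := Option.ne_none_iff_exists'.1 hvn
    rw [mem_linkClass] at hg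
    refine hfW (mem_linkClass.2 (hg.tail ⟨?_, v, (hX _ _).1 hvg, (hX _ _).1 hvf⟩))
    rw [← hg.col_eq, he, (hcol f).1 hf]

/-- The wings of a colour class at the apex are the classes of linked edges. -/
theorem wingCount_colorClass
    (hX : ∀ e (v : Fin m), some v ∈ G.ends e ↔ (v : ℕ) ∈ X e) (hXm : ∀ e, X e ⊆ range m)
    (hapex : ∀ e, col e = j → ∃ f, Linked col X e f ∧ none ∈ G.ends f) :
    (G.colorClass col j).wingCount none = #(image (linkClass col X) {e | col e = j}) := by
  rw [Sub.wingCount, ← Set.ncard_coe_finset, ← Set.InjOn.ncard_image (f := Sub.edges)]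
  · congr 1
    ext P
    simp only [Set.mem_image, Set.mem_ofPred_eq, coe_image, coe_filter, mem_univ, true_and]
    constructor
    · rintro ⟨W, hW, rfl⟩
      obtain ⟨e, he⟩ := hW.nontrivial
      exact ⟨e, by simpa [colorClass] using hW.edges_subset he,
        (hW.edges_eq_linkClass hX hXm he).symm⟩
    · rintro ⟨e, he, rfl⟩
      exact exists_isWing_linkClass hX hXm he (hapex e he)
  · intro W hW W' hW' hE
    have hv : W.verts = W'.verts := by
      ext v
      rw [Sub.IsWing.mem_verts_iff hW, Sub.IsWing.mem_verts_iff hW', hE]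
    cases W
    cases W'
    simp only at hv hE
    subst hv hE
    rfl

end Wings

/-! ### Edge bijections and edge counts. -/

open Classical in
theorem card_filter_compl_range {A O Y : Type*} [Fintype A] [Fintype O] [DecidableEq Y]
    {i : O → A} (hi : Function.Injective i) (g : A → Y) (y : Y) :
    #{a : ((Set.range i)ᶜ : Set A) | g a = y} + #{o | g (i o) = y} = #{a | g a = y} := by
  rw [← card_map (Function.Embedding.subtype _), ← card_map ⟨i, hi⟩, ← card_union_of_disjoint]
  · congr 1
    ext a
    simp only [mem_union, mem_map, mem_filter, mem_univ, true_and]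
    constructor
    · rintro (⟨a, ha, rfl⟩ | ⟨o, ho, rfl⟩)
      · exact ha
      · exact ho
    · intro ha
      by_cases har : a ∈ Set.range i
      · obtain ⟨o, rfl⟩ := har
        exact Or.inr ⟨o, ha, rfl⟩
      · exact Or.inl ⟨⟨a, har⟩, ha, rfl⟩
  · rw [disjoint_left]
    intro a ha ha'
    obtain ⟨⟨b, hb⟩, _, rfl⟩ := mem_map.1 ha
    obtain ⟨o, _, ho⟩ := mem_map.1 ha'
    exact hb ⟨o, ho⟩

/-- Two maps with equally large fibres, that agree on common parts of their domains, differ by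
a bijection that respects the common part. -/
theorem exists_equiv_of_card_fiber_eq {A B O Y : Type*} [Fintype A] [Fintype B] [Fintype O]
    [DecidableEq Y] {i : O → A} {i' : O → B} (hi : Function.Injective i)
    (hi' : Function.Injective i') {g : A → Y} {g' : B → Y} (hg : ∀ o, g (i o) = g' (i' o))
    (hc : ∀ y, #{a | g a = y} = #{b | g' b = y}) :
    ∃ φ : A ≃ B, (∀ o, φ (i o) = i' o) ∧ ∀ a, g' (φ a) = g a := by
  classical
  have hfib : ∀ y, Nonempty ({a : ((Set.range i)ᶜ : Set A) // g a = y} ≃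
      {b : ((Set.range i')ᶜ : Set B) // g' b = y}) := by
    intro y
    rw [← Fintype.card_eq, Fintype.card_subtype, Fintype.card_subtype]
    have h1 := card_filter_compl_range hi g y
    have h2 := card_filter_compl_range hi' g' y
    have h3 := hc y
    simp only [hg] at h1
    omega
  let ψ := ((Equiv.sigmaFiberEquiv fun a : ((Set.range i)ᶜ : Set A) => g a).symm.trans
    (Equiv.sigmaCongrRight fun y => (hfib y).some)).trans
    (Equiv.sigmaFiberEquiv fun b : ((Set.range i')ᶜ : Set B) => g' b)
  have hψ : ∀ a, g' (ψ a) = g a := fun a => ((hfib (g a)).some ⟨a, rfl⟩).2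
  let φ := ((Equiv.Set.sumCompl (Set.range i)).symm.trans (Equiv.sumCongr
    ((Equiv.ofInjective i hi).symm.trans (Equiv.ofInjective i' hi')) ψ)).trans
    (Equiv.Set.sumCompl (Set.range i'))
  have hφ : ∀ o, φ (i o) = i' o := by
    intro o
    have h1 : (Equiv.Set.sumCompl (Set.range i)).symm (i o) = Sum.inl ⟨i o, o, rfl⟩ :=
      Equiv.Set.sumCompl_symm_apply_of_mem _
    have h2 : (Equiv.ofInjective i hi).symm ⟨i o, o, rfl⟩ = o :=
      (Equiv.symm_apply_eq _).2 rfl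
    simp [φ, h1, h2]
  refine ⟨φ, hφ, fun a => ?_⟩
  by_cases ha : a ∈ Set.range i
  · obtain ⟨o, rfl⟩ := ha
    rw [hφ, hg]
  · have h1 : (Equiv.Set.sumCompl (Set.range i)).symm a = Sum.inr ⟨a, ha⟩ :=
      Equiv.Set.sumCompl_symm_apply_of_notMem ha
    simp [φ, h1, hψ]

/-- The set of vertices of an edge of `lam • K_n^h`, as natural numbers. -/
def CompleteEdge.vertices {lam h n : ℕ} (e : CompleteEdge lam h (Fin n)) : Finset ℕ :=
  e.2.1.map Fin.valEmbedding

theorem CompleteEdge.card_vertices {lam h n : ℕ} (e : CompleteEdge lam h (Fin n)) :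
    #e.vertices = h := by
  rw [vertices, card_map, e.2.2]

theorem CompleteEdge.vertices_subset {lam h n : ℕ} (e : CompleteEdge lam h (Fin n)) :
    e.vertices ⊆ range n := by
  intro v hv
  obtain ⟨x, _, rfl⟩ := mem_map.1 hv
  exact mem_range.2 x.2

theorem CompleteEdge.vertices_castLE {lam h m n : ℕ} (hmn : m ≤ n)
    (e : CompleteEdge lam h (Fin m)) : (CompleteEdge.castLE hmn e).vertices = e.vertices := by
  simp only [vertices, castLE, map_map]
  rfl

theorem CompleteEdge.castLE_injective {lam h m n : ℕ} (hmn : m ≤ n) :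
    Function.Injective (CompleteEdge.castLE (lam := lam) (h := h) hmn) := by
  rintro ⟨a, s, hs⟩ ⟨b, t, ht⟩ hst
  simp only [castLE, Prod.mk.injEq, Subtype.mk.injEq, map_inj] at hst
  obtain ⟨rfl, rfl⟩ := hst
  rfl

/-- An edge with trace `Y` below `M` is completed by `h - #Y` vertices from `Ico M n`. The case `M =
n` counts the copies of a full edge. -/
theorem CompleteEdge.card_filter_lt_eq {lam h M n : ℕ} (hM : M ≤ n) (Y : Finset ℕ)
    (hY : Y ⊆ range M) (hYh : #Y ≤ h) :
    #{e : CompleteEdge lam h (Fin n) | {v ∈ e.vertices | v < M} = Y}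
      = lam * (n - M).choose (h - #Y) := by
  have h1 : ({e : CompleteEdge lam h (Fin n) | {v ∈ e.vertices | v < M} = Y} : Finset _)
      = (univ : Finset (Fin lam)) ×ˢ
          ({s | {v ∈ s.1.map Fin.valEmbedding | v < M} = Y} :
            Finset {s : Finset (Fin n) // s.card = h}) := by
    ext e
    rw [mem_filter, mem_product, mem_filter]
    simp [vertices]
  rw [h1, card_product, card_univ, Fintype.card_fin, ← Nat.card_Ico, ← card_powersetCard]
  congr 1
  have hYM : ∀ v ∈ Y, v < M := fun v hv => mem_range.1 (hY hv)
  refine card_bij (fun s _ => {v ∈ s.1.map Fin.valEmbedding | ¬ v < M}) ?_ ?_ ?_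
  · intro s hs
    have hs' : {v ∈ s.1.map Fin.valEmbedding | v < M} = Y := by simpa using hs
    have h2 := card_filter_add_card_filter_not (s := s.1.map Fin.valEmbedding) (fun v => v < M)
    rw [hs', card_map, s.2] at h2
    rw [mem_powersetCard]
    refine ⟨fun v hv => ?_, by omega⟩
    obtain ⟨hv1, hv2⟩ := mem_filter.1 hv
    obtain ⟨x, _, rfl⟩ := mem_map.1 hv1
    exact mem_Ico.2 ⟨not_lt.1 hv2, x.2⟩
  · intro s hs t ht hst
    have hs' : {v ∈ s.1.map Fin.valEmbedding | v < M} = Y := by simpa using hs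
    have ht' : {v ∈ t.1.map Fin.valEmbedding | v < M} = Y := by simpa using ht
    apply Subtype.ext
    apply map_injective Fin.valEmbedding
    rw [← filter_union_filter_not_eq (fun v => v < M) (s.1.map Fin.valEmbedding), hs', hst, ← ht',
      filter_union_filter_not_eq]
  · intro t ht
    obtain ⟨ht1, ht2⟩ := mem_powersetCard.1 ht
    have htM : ∀ v ∈ t, ¬ v < M := fun v hv => not_lt.2 (mem_Ico.1 (ht1 hv)).1
    have hlt : ∀ v ∈ Y ∪ t, v < n := by
      intro v hv
      rcases mem_union.1 hv with hv | hv
      · exact (hYM v hv).trans_le hM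
      · exact (mem_Ico.1 (ht1 hv)).2
    have hmap : ((Y ∪ t).attachFin hlt).map Fin.valEmbedding = Y ∪ t :=
      map_valEmbedding_attachFin hlt
    refine ⟨⟨(Y ∪ t).attachFin hlt, ?_⟩, ?_, ?_⟩
    · rw [card_attachFin, card_union_of_disjoint, ht2]
      · omega
      · rw [disjoint_left]
        exact fun v hv hv' => htM v hv' (hYM v hv)
    · simp only [mem_filter, mem_univ, true_and]
      rw [hmap, filter_union, filter_true_of_mem hYM, filter_false_of_mem htM, union_empty]
    · simp only
      rw [hmap, filter_union, filter_true_of_mem htM,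
        filter_false_of_mem fun v hv => not_not.2 (hYM v hv), empty_union]

/-! ### Degrees and edge types of the amalgamation. -/

section Amalgam

variable {lam h m n : ℕ}

/-- The set of ordinary vertices of an edge of the amalgamation, as natural numbers. -/
def ordinaryVertices : CompleteEdge lam h (Fin m) ⊕ NewEdge lam h m n → Finset ℕ :=
  Sum.elim CompleteEdge.vertices fun e => e.1.1.map Fin.valEmbedding

theorem count_some_ends_amalgam (e : CompleteEdge lam h (Fin m) ⊕ NewEdge lam h m n) (v : Fin m) :
    ((amalgam lam h m n).ends e).count (some v)
      = if (v : ℕ) ∈ ordinaryVertices e then 1 else 0 := by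
  have key : ∀ s : Finset (Fin m), (s.val.map some).count (some v)
      = if (v : ℕ) ∈ s.map Fin.valEmbedding then 1 else 0 := by
    intro s
    rw [Multiset.count_map_eq_count' _ _ (Option.some_injective _),
      Multiset.count_eq_of_nodup s.nodup]
    refine if_congr ?_ rfl rfl
    rw [mem_val]
    exact (mem_map' Fin.valEmbedding).symm
  cases e with
  | inl e => exact key _
  | inr e =>
    simp only [amalgam, Multiset.count_add, Multiset.count_replicate]
    rw [key, if_neg (Option.some_ne_none v).symm, zero_add]
    rfl

theorem count_none_ends_amalgam (e : CompleteEdge lam h (Fin m) ⊕ NewEdge lam h m n) :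
    ((amalgam lam h m n).ends e).count none = h - #(ordinaryVertices e) := by
  have key : ∀ s : Finset (Fin m), (s.val.map some).count none = 0 := by
    intro s
    rw [Multiset.count_eq_zero]
    simp
  cases e with
  | inl e =>
    rw [ordinaryVertices, Sum.elim_inl, CompleteEdge.card_vertices, Nat.sub_self]
    exact key _
  | inr e =>
    simp only [amalgam, Multiset.count_add, Multiset.count_replicate]
    rw [key, add_zero, ordinaryVertices, Sum.elim_inr, card_map]
    exact if_pos trivial

theorem some_mem_ends_amalgam (e : CompleteEdge lam h (Fin m) ⊕ NewEdge lam h m n) (v : Fin m) :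
    some v ∈ (amalgam lam h m n).ends e ↔ (v : ℕ) ∈ ordinaryVertices e := by
  rw [← Multiset.count_pos, count_some_ends_amalgam]
  split_ifs with hv <;> simp [hv]

theorem none_mem_ends_amalgam (e : CompleteEdge lam h (Fin m) ⊕ NewEdge lam h m n) :
    none ∈ (amalgam lam h m n).ends e ↔ #(ordinaryVertices e) < h := by
  rw [← Multiset.count_pos, count_none_ends_amalgam]
  omega

theorem degree_some_amalgam {k : ℕ} (col : CompleteEdge lam h (Fin m) ⊕ NewEdge lam h m n → Fin k)
    (j : Fin k) (v : Fin m) :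
    ((amalgam lam h m n).colorClass col j).degree (some v)
      = #{e | col e = j ∧ (v : ℕ) ∈ ordinaryVertices e} := by
  rw [Sub.degree, ← filter_filter, card_filter]
  exact sum_congr rfl fun e _ => count_some_ends_amalgam e v

theorem degree_none_amalgam {k : ℕ} (col : CompleteEdge lam h (Fin m) ⊕ NewEdge lam h m n → Fin k)
    (j : Fin k) :
    ((amalgam lam h m n).colorClass col j).degree none
      = ∑ e with col e = j, (h - #(ordinaryVertices e)) :=
  sum_congr rfl fun e _ => count_none_ends_amalgam e

theorem degree_complete {k : ℕ} (col : CompleteEdge lam h (Fin n) → Fin k) (j : Fin k)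
    (v : Fin n) :
    ((complete lam h (Fin n)).colorClass col j).degree v
      = #{e | col e = j ∧ (v : ℕ) ∈ e.vertices} := by
  rw [Sub.degree, ← filter_filter, card_filter]
  refine sum_congr rfl fun e _ => ?_
  simp only [complete, CompleteEdge.vertices]
  rw [Multiset.count_eq_of_nodup e.2.1.nodup]
  refine if_congr ?_ rfl rfl
  rw [mem_val]
  exact (mem_map' Fin.valEmbedding).symm

theorem ordinaryVertices_subset (e : CompleteEdge lam h (Fin m) ⊕ NewEdge lam h m n) :
    ordinaryVertices e ⊆ range m := by
  cases e with
  | inl e => exact e.vertices_subset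
  | inr e =>
    intro v hv
    obtain ⟨x, _, rfl⟩ := mem_map.1 hv
    exact mem_range.2 x.2

theorem card_ordinaryVertices_le (e : CompleteEdge lam h (Fin m) ⊕ NewEdge lam h m n) :
    #(ordinaryVertices e) ≤ h := by
  cases e with
  | inl e => exact e.card_vertices.le
  | inr e =>
    rw [ordinaryVertices, Sum.elim_inr, card_map]
    exact e.1.2.le

/-- Old edges contribute only when `#Y = h`, new ones only when `#Y < h`. The value agrees with
`CompleteEdge.card_filter_lt_eq`, so identifying vertices in the complete hypergraph gives the same
edge types. -/
theorem card_ordinaryVertices_eq (Y : Finset ℕ) (hY : Y ⊆ range m) (hYh : #Y ≤ h) :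
    #{e : CompleteEdge lam h (Fin m) ⊕ NewEdge lam h m n | ordinaryVertices e = Y}
      = lam * (n - m).choose (h - #Y) := by
  have h1 : #{e : CompleteEdge lam h (Fin m) | e.vertices = Y}
      = lam * (0 : ℕ).choose (h - #Y) := by
    rw [← Nat.sub_self m, ← CompleteEdge.card_filter_lt_eq le_rfl Y hY hYh]
    congr 1
    refine filter_congr fun e _ => ?_
    rw [filter_true_of_mem fun v hv => mem_range.1 (e.vertices_subset hv)]
  rw [card_filter, Fintype.sum_sum_type]
  have h2 : ∑ e : CompleteEdge lam h (Fin m),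
      (if ordinaryVertices (n := n) (Sum.inl e) = Y then 1 else 0)
      = lam * (0 : ℕ).choose (h - #Y) := by
    rw [← h1, card_filter]
    exact sum_congr rfl fun e _ => if_congr Iff.rfl rfl rfl
  have h3 : ∑ e : NewEdge lam h m n, (if ordinaryVertices (Sum.inr e) = Y then 1 else 0)
      = ∑ e : NewEdge lam h m n, if e.1.1.map Fin.valEmbedding = Y then 1 else 0 :=
    sum_congr rfl fun e _ => if_congr Iff.rfl rfl rfl
  have h4 : ∀ Z : {X : Finset (Fin m) // X.card < h},
      ∑ _x : Fin (lam * (n - m).choose (h - Z.1.card)),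
        (if Z.1.map Fin.valEmbedding = Y then 1 else 0)
      = if Z.1.map Fin.valEmbedding = Y then lam * (n - m).choose (h - Z.1.card) else 0 := by
    intro Z
    rw [sum_const, card_univ, Fintype.card_fin, smul_eq_mul, mul_ite, mul_one, mul_zero]
  rw [h2, h3, Fintype.sum_sigma, sum_congr rfl fun Z _ => h4 Z]
  rcases hYh.lt_or_eq with hlt | heq
  · have hlt' : ∀ v ∈ Y, v < m := fun v hv => mem_range.1 (hY hv)
    have hmap : (Y.attachFin hlt').map Fin.valEmbedding = Y := map_valEmbedding_attachFin hlt'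
    rw [Nat.choose_eq_zero_of_lt (by omega : 0 < h - #Y), mul_zero, zero_add,
      sum_eq_single (⟨Y.attachFin hlt', by rwa [card_attachFin]⟩ :
        {X : Finset (Fin m) // X.card < h})]
    · rw [if_pos hmap, card_attachFin]
    · intro Z _ hZ
      refine if_neg fun hZY => hZ (Subtype.ext (map_injective Fin.valEmbedding ?_))
      rw [hZY, hmap]
    · exact fun hh => absurd (mem_univ _) hh
  · rw [heq, Nat.sub_self, Nat.choose_zero_right, Nat.choose_zero_right, sum_eq_zero, add_zero]
    intro Z _
    refine if_neg fun hZY => ?_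
    have := Z.2
    rw [← card_map Fin.valEmbedding, hZY] at this
    omega

end Amalgam

/-! ### The bound on wings forced by connectedness. -/

/-- In a connected regular colour class, the classes of edges that are linked through the vertices
below `m` are joined by the vertices `m, …, n - 1`, so that there are not too many of them. -/
theorem card_image_linkClass_le {E κ : Type*} [Fintype E] [DecidableEq E] [DecidableEq κ]
    {col : E → κ} {Z X : E → Finset ℕ} {m n r : ℕ} (hmn : m < n) (hr : 0 < r)
    (hX : ∀ e, X e = {v ∈ Z e | v < m}) (hZ : ∀ e, Z e ⊆ range n) (j : κ)
    (hdeg : ∀ v < n, #{e | col e = j ∧ v ∈ Z e} = r)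
    (hlink : ∀ e f, col e = j → col f = j → Linked col Z e f) :
    #(image (linkClass col X) {e | col e = j}) ≤ (r - 1) * (n - m) + 1 := by
  classical
  set B := image (linkClass col X) {e | col e = j} with hB
  have hmem : ∀ e, col e = j → linkClass col X e ∈ B := fun e he =>
    mem_image_of_mem _ (by simpa using he)
  let G : SimpleGraph (Ico m n ⊕ B) := SimpleGraph.fromRel fun a b =>
    ∃ (v : Ico m n) (l : B), a = Sum.inl v ∧ b = Sum.inr l ∧
      ∃ e, col e = j ∧ v.1 ∈ Z e ∧ linkClass col X e = l
  have hadj : ∀ (v : Ico m n) e (he : col e = j), v.1 ∈ Z e →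
      G.Adj (Sum.inl v) (Sum.inr ⟨linkClass col X e, hmem e he⟩) := by
    intro v e he hv
    rw [SimpleGraph.fromRel_adj]
    exact ⟨Sum.inl_ne_inr, Or.inl ⟨v, _, rfl, rfl, e, he, hv, rfl⟩⟩
  have hreach : ∀ e (he : col e = j) f (hf : col f = j),
      G.Reachable (Sum.inr ⟨linkClass col X e, hmem e he⟩)
        (Sum.inr ⟨linkClass col X f, hmem f hf⟩) := by
    intro e he f hf
    have h := hlink e f he hf
    induction h with
    | refl => exact SimpleGraph.Reachable.refl _
    | tail h1 h2 ih =>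
      rename_i f g
      obtain ⟨hc, v, hvf, hvg⟩ := h2
      have hfj : col f = j := hc.trans hf
      refine (ih hfj).trans ?_
      -- A shared vertex below `m` keeps the link class; any other is a node of `G` adjacent to both
      -- classes.
      by_cases hv : v < m
      · have h3 : linkClass col X f = linkClass col X g := by
          rw [linkClass_eq_iff]
          refine .single ⟨hc, v, ?_, ?_⟩ <;> rw [hX, mem_filter]
          · exact ⟨hvf, hv⟩
          · exact ⟨hvg, hv⟩
        have h4 : (⟨linkClass col X f, hmem f hfj⟩ : B) = ⟨linkClass col X g, hmem g hf⟩ :=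
          Subtype.ext h3
        rw [h4]
      · let v' : Ico m n := ⟨v, mem_Ico.2 ⟨not_lt.1 hv, mem_range.1 (hZ f hvf)⟩⟩
        exact (hadj v' f hfj hvf).symm.reachable.trans (hadj v' g hf hvg).reachable
  have hedge : ∀ v < n, ∃ e, col e = j ∧ v ∈ Z e := by
    intro v hv
    have h1 := hdeg v hv
    obtain ⟨e, he⟩ := card_pos.1 (h1 ▸ hr)
    exact ⟨e, (mem_filter.1 he).2⟩
  obtain ⟨e₀, he₀, -⟩ := hedge m hmn
  have hconn : G.Connected := by
    have hroot : ∀ a, G.Reachable a (Sum.inr ⟨linkClass col X e₀, hmem e₀ he₀⟩) := by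
      rintro (v | ⟨l, hl⟩)
      · obtain ⟨e, he, hv⟩ := hedge v.1 (mem_Ico.1 v.2).2
        exact (hadj v e he hv).reachable.trans (hreach e he e₀ he₀)
      · obtain ⟨e, he, rfl⟩ := mem_image.1 hl
        exact hreach e (by simpa using he) e₀ he₀
    exact (SimpleGraph.connected_iff G).2
      ⟨fun a b => (hroot a).trans (hroot b).symm, ⟨Sum.inr ⟨_, hmem e₀ he₀⟩⟩⟩
  have hcard := hconn.card_vert_le_card_edgeSet_add_one
  -- The `r (n - m)` incidences map onto the edges of `G`, and a connected graph has at most one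
  -- more node than edges.
  let D := Σ v : Ico m n, {e // col e = j ∧ v.1 ∈ Z e}
  let f : D → G.edgeSet := fun q =>
    ⟨s(Sum.inl q.1, Sum.inr ⟨linkClass col X q.2.1, hmem _ q.2.2.1⟩), hadj q.1 _ q.2.2.1 q.2.2.2⟩
  have hf : Function.Surjective f := by
    rintro ⟨q, hq⟩
    induction q using Sym2.ind with
    | _ a b =>
      have hab : G.Adj a b := hq
      rw [SimpleGraph.fromRel_adj] at hab
      obtain ⟨-, ⟨v, l, rfl, rfl, e, he, hv, hl⟩ | ⟨v, l, rfl, rfl, e, he, hv, hl⟩⟩ := hab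
      · refine ⟨⟨v, e, he, hv⟩, Subtype.ext ?_⟩
        simp only [f]
        congr
      · refine ⟨⟨v, e, he, hv⟩, Subtype.ext ?_⟩
        simp only [f]
        rw [Sym2.eq_swap]
        congr
  have hle := Nat.card_le_card_of_surjective f hf
  have hD : Nat.card D = (n - m) * r := by
    rw [Nat.card_eq_fintype_card, Fintype.card_sigma, sum_congr rfl fun v _ => by
      rw [Fintype.card_subtype, hdeg v.1 (mem_Ico.1 v.2).2]]
    simp
  rw [Nat.card_eq_fintype_card, Fintype.card_sum, Fintype.card_coe, Fintype.card_coe,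
    Nat.card_Ico] at hcard
  rw [hD] at hle
  obtain ⟨r, rfl⟩ := Nat.exists_eq_add_of_le' hr
  rw [Nat.add_sub_cancel]
  nlinarith

/-! ### The two directions of the equivalence. -/

section Main

variable {lam h m n k : ℕ}

theorem meets_complete {d : CompleteEdge lam h (Fin n) → Fin k} (e f : CompleteEdge lam h (Fin n)) :
    (Meets d CompleteEdge.vertices e f ↔ d e = d f ∧ ∃ v ∈ (complete lam h (Fin n)).ends e,
      v ∈ (complete lam h (Fin n)).ends f) := by
  refine and_congr Iff.rfl ⟨?_, ?_⟩
  · rintro ⟨v, hv, hv'⟩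
    obtain ⟨x, hx, rfl⟩ := mem_map.1 hv
    exact ⟨x, hx, (mem_map' Fin.valEmbedding).1 hv'⟩
  · rintro ⟨x, hx, hx'⟩
    exact ⟨x, (mem_map' Fin.valEmbedding).2 hx, (mem_map' Fin.valEmbedding).2 hx'⟩

theorem Linked.of_comp {A B κ : Type*} {col : B → κ} {X : B → Finset ℕ} (φ : A ≃ B) {a b : B}
    (hab : Linked col X a b) : Linked (col ∘ φ) (X ∘ φ) (φ.symm a) (φ.symm b) := by
  refine Relation.ReflTransGen.lift φ.symm (fun a b hm => ?_) _ _ hab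
  obtain ⟨hc, v, hv, hv'⟩ := hm
  exact ⟨by simpa using hc, v, by simpa using hv, by simpa using hv'⟩

theorem card_filter_comp_equiv {A B : Type*} [Fintype A] [Fintype B] (φ : A ≃ B) (P : B → Prop)
    [DecidablePred P] : #{a | P (φ a)} = #{b | P b} := by
  rw [← card_map φ.toEmbedding]
  congr 1
  ext b
  simp only [mem_map, mem_filter, mem_univ, true_and, Equiv.coe_toEmbedding]
  constructor
  · rintro ⟨a, ha, rfl⟩
    exact ha
  · exact fun hb => ⟨φ.symm b, by simpa using hb, by simp⟩

theorem exists_extension_of_amalgam {r : ℕ} (hh : 0 < h) (hmn : m < n) (hr : 0 < r) [NeZero k]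
    {c : CompleteEdge lam h (Fin m) → Fin k} {c' : NewEdge lam h m n → Fin k}
    (hc' : ∀ j : Fin k,
      (∀ v : Fin m, ((amalgam lam h m n).colorClass (Sum.elim c c') j).degree (some v) = r) ∧
      ((amalgam lam h m n).colorClass (Sum.elim c c') j).degree none = r * (n - m) ∧
      ((amalgam lam h m n).colorClass (Sum.elim c c') j).Connected ∧
      ((amalgam lam h m n).colorClass (Sum.elim c c') j).wingCount none ≤ (r - 1) * (n - m) + 1) :
    ∃ d : CompleteEdge lam h (Fin n) → Fin k, Extends hmn.le d c ∧
      (complete lam h (Fin n)).IsConnectedFactorization r d := by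
  classical
  set col := Sum.elim c c' with hcol
  obtain ⟨p, rfl⟩ : ∃ p, n = m + (p + 1) := ⟨n - m - 1, by omega⟩
  have hp : m + (p + 1) - m = p + 1 := by omega
  have hapex : ∀ e, ∃ f, Linked col ordinaryVertices e f ∧
      none ∈ (amalgam lam h m (m + (p + 1))).ends f := by
    intro e
    by_cases he : #(ordinaryVertices e) < h
    · exact ⟨e, .refl, (none_mem_ends_amalgam e).2 he⟩
    · obtain ⟨v, hv⟩ := card_pos.1 (hh.trans_le (not_lt.1 he))
      have hvm := mem_range.1 (ordinaryVertices_subset e hv)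
      exact exists_linked_apex some_mem_ends_amalgam
        ((hc' (col e)).2.2.1.2 (some ⟨v, hvm⟩) (mem_univ _) none (mem_univ _)) rfl
        ((some_mem_ends_amalgam e ⟨v, hvm⟩).2 hv)
  have S : IsConnectedAmalgam lam h r m (p + 1) col ordinaryVertices
      (linkClass col ordinaryVertices) := by
    refine ⟨ordinaryVertices_subset, card_ordinaryVertices_le, ?_, ?_, ?_, ?_, ?_, ?_, ?_⟩
    · intro Y hY hYh
      rw [card_ordinaryVertices_eq Y hY hYh, hp]
    · intro j v hv
      rw [← (hc' j).1 ⟨v, hv⟩, degree_some_amalgam]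
    · intro j
      rw [← degree_none_amalgam, (hc' j).2.1, hp]
    · exact fun e f hef => (linkClass_eq_iff.1 hef).col_eq
    · exact fun e f hef => linkClass_eq_iff.1 hef
    · intro e
      obtain ⟨f, hf, hf'⟩ := hapex e
      exact ⟨f, linkClass_eq_iff.2 hf.symm, (none_mem_ends_amalgam f).1 hf'⟩
    · intro j
      have h1 := (hc' j).2.2.2
      rw [wingCount_colorClass some_mem_ends_amalgam ordinaryVertices_subset fun e _ => hapex e]
        at h1
      exact h1.trans_eq (by rw [hp])
  obtain ⟨Z, hZn, hZh, hZfib, hZdeg, hZlink, hZX⟩ := S.exists_detachment hr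
  -- Old edges already have `h` ordinary vertices and were never altered, so the bijection with the
  -- detached edges can fix them; the transported colouring then extends `c`.
  obtain ⟨φ, hφ, hφZ⟩ := exists_equiv_of_card_fiber_eq (CompleteEdge.castLE_injective hmn.le)
    (Sum.inl_injective (α := CompleteEdge lam h (Fin m)) (β := NewEdge lam h m (m + (p + 1))))
    (g := CompleteEdge.vertices) (g' := Z) (fun o => by
      have h1 : ordinaryVertices (n := m + (p + 1)) (Sum.inl o) = o.vertices := rfl
      rw [CompleteEdge.vertices_castLE, hZX _ (by rw [h1, o.card_vertices]), h1]) (fun Y => by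
      by_cases hY : Y ⊆ range (m + (p + 1)) ∧ #Y = h
      · have h1 := CompleteEdge.card_filter_lt_eq (lam := lam) le_rfl Y hY.1 hY.2.le
        rw [hY.2, Nat.sub_self, Nat.sub_self, Nat.choose_self, mul_one] at h1
        refine (Eq.trans (congrArg card (filter_congr fun e _ => ?_)) h1).trans
          (hZfib Y hY.1 hY.2).symm
        rw [filter_true_of_mem fun v hv => mem_range.1 (e.vertices_subset hv)]
      · rw [filter_false_of_mem, filter_false_of_mem, card_empty, card_empty]
        · rintro e - rfl
          exact hY ⟨hZn e, hZh e⟩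
        · rintro e - rfl
          exact hY ⟨e.vertices_subset, e.card_vertices⟩)
  have hcomp : Z ∘ φ = CompleteEdge.vertices := funext hφZ
  have hdeg : ∀ j (v : Fin (m + (p + 1))),
      #{e | (col ∘ φ) e = j ∧ (v : ℕ) ∈ e.vertices} = r := by
    intro j v
    rw [← hZdeg j v v.2, ← card_filter_comp_equiv φ]
    congr 1
    refine filter_congr fun e _ => ?_
    rw [hφZ]
    rfl
  refine ⟨col ∘ φ, ?_, ?_⟩
  · intro e
    rw [Function.comp_apply, hφ]
    rfl
  · intro j
    refine ⟨fun v => by rw [degree_complete]; exact hdeg j v, ⟨⟨0, by omega⟩, mem_univ _⟩, ?_⟩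
    intro u _ v _
    have hedge : ∀ v : Fin (m + (p + 1)), ∃ e : CompleteEdge lam h (Fin (m + (p + 1))),
        (col ∘ φ) e = j ∧ v ∈ (complete lam h _).ends e := by
      intro v
      have h1 := hdeg j v
      obtain ⟨e, he⟩ := card_pos.1 (h1 ▸ hr)
      obtain ⟨he1, he2⟩ := (mem_filter.1 he).2
      exact ⟨e, he1, (mem_map' Fin.valEmbedding).1 he2⟩
    obtain ⟨e, he, hu⟩ := hedge u
    obtain ⟨f, hf, hv⟩ := hedge v
    have h1 := (hZlink (φ e) (φ f) (he.trans hf.symm)).of_comp φ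
    rw [Equiv.symm_apply_apply, Equiv.symm_apply_apply, hcomp] at h1
    refine h1.reflTransGen (fun a b hab => ((meets_complete a b).1 hab).2) ?_ hu hv
    intro g hg
    simp only [colorClass, mem_filter, mem_univ, true_and]
    rw [← hg.col_eq, he]

theorem exists_coloring_of_extension {r : ℕ} (hh : 0 < h) (hmn : m < n) (hr : 0 < r)
    {c : CompleteEdge lam h (Fin m) → Fin k} {d : CompleteEdge lam h (Fin n) → Fin k}
    (hdc : Extends hmn.le d c) (hd : (complete lam h (Fin n)).IsConnectedFactorization r d) :
    ∃ c' : NewEdge lam h m n → Fin k, ∀ j : Fin k,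
      (∀ v : Fin m, ((amalgam lam h m n).colorClass (Sum.elim c c') j).degree (some v) = r) ∧
      ((amalgam lam h m n).colorClass (Sum.elim c c') j).degree none = r * (n - m) ∧
      ((amalgam lam h m n).colorClass (Sum.elim c c') j).Connected ∧
      ((amalgam lam h m n).colorClass (Sum.elim c c') j).wingCount none
        ≤ (r - 1) * (n - m) + 1 := by
  classical
  -- Edges are matched by their trace below `m`; what lies beyond it becomes the apex.
  obtain ⟨φ, hφ, hφX⟩ := exists_equiv_of_card_fiber_eq (CompleteEdge.castLE_injective hmn.le)
    (Sum.inl_injective (α := CompleteEdge lam h (Fin m)) (β := NewEdge lam h m n))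
    (g := fun e => {v ∈ e.vertices | v < m}) (g' := ordinaryVertices) (fun o => by
      rw [CompleteEdge.vertices_castLE, filter_true_of_mem fun v hv =>
        mem_range.1 (o.vertices_subset hv)]
      rfl) (fun Y => by
      by_cases hY : Y ⊆ range m ∧ #Y ≤ h
      · rw [CompleteEdge.card_filter_lt_eq hmn.le Y hY.1 hY.2,
          card_ordinaryVertices_eq Y hY.1 hY.2]
      · rw [filter_false_of_mem, filter_false_of_mem, card_empty, card_empty]
        · rintro e - rfl
          exact hY ⟨ordinaryVertices_subset e, card_ordinaryVertices_le e⟩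
        · rintro e - rfl
          exact hY ⟨fun v hv => mem_range.2 (mem_filter.1 hv).2,
            (card_le_card (filter_subset _ _)).trans e.card_vertices.le⟩)
  let col := d ∘ φ.symm
  let Z := CompleteEdge.vertices ∘ φ.symm
  have hX : ∀ e, ordinaryVertices e = {v ∈ Z e | v < m} := by
    intro e
    have := hφX (φ.symm e)
    rwa [Equiv.apply_symm_apply] at this
  have hZn : ∀ e, Z e ⊆ range n := fun e => (φ.symm e).vertices_subset
  have hZh : ∀ e, #(Z e) = h := fun e => (φ.symm e).card_vertices
  have hdeg : ∀ j, ∀ v < n, #{e | col e = j ∧ v ∈ Z e} = r := by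
    intro j v hv
    rw [← (hd j).1 ⟨v, hv⟩, degree_complete]
    exact card_filter_comp_equiv φ.symm fun e => d e = j ∧ v ∈ e.vertices
  have hlink : ∀ j e f, col e = j → col f = j → Linked col Z e f := by
    intro j e f he hf
    have hedge : ∀ e : CompleteEdge lam h (Fin n), ∃ v, v ∈ (complete lam h (Fin n)).ends e := by
      intro e
      obtain ⟨v, hv⟩ := card_pos.1 (e.2.2.symm ▸ hh : 0 < #e.2.1)
      exact ⟨v, hv⟩
    obtain ⟨u, hu⟩ := hedge (φ.symm e)
    obtain ⟨v, hv⟩ := hedge (φ.symm f)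
    have h1 : Linked d CompleteEdge.vertices (φ.symm e) (φ.symm f) :=
      linked_of_reflTransGen (fun a b v hab hva hvb => (meets_complete a b).2 ⟨hab, v, hva, hvb⟩)
        (fun g hg => by simpa [colorClass] using hg)
        ((hd j).2.2 u (mem_univ _) v (mem_univ _)) he hf hu hv
    have h2 := h1.of_comp φ.symm
    rwa [Equiv.symm_symm, Equiv.apply_symm_apply, Equiv.apply_symm_apply] at h2
  have hcol : Sum.elim c (col ∘ Sum.inr) = col := by
    funext e
    cases e with
    | inl e =>
      rw [Sum.elim_inl, ← hdc e]
      simp only [col, Function.comp_apply]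
      rw [← hφ, Equiv.symm_apply_apply]
    | inr e => rfl
  refine ⟨col ∘ Sum.inr, fun j => ?_⟩
  rw [hcol]
  have hsome : ∀ v : Fin m, #{e | col e = j ∧ (v : ℕ) ∈ ordinaryVertices e} = r := by
    intro v
    rw [← hdeg j v (v.2.trans hmn)]
    congr 1
    refine filter_congr fun e _ => ?_
    rw [hX, mem_filter]
    exact ⟨fun hv => ⟨hv.1, hv.2.1⟩, fun hv => ⟨hv.1, hv.2, v.2⟩⟩
  have hnone : ∑ e with col e = j, (h - #(ordinaryVertices e)) = r * (n - m) := by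
    -- The apex multiplicity counts the identified vertices in the edge; summing over edges first
    -- gives `r` for each of them.
    have h1 : ∀ e, h - #(ordinaryVertices e) = ∑ v ∈ Ico m n, if v ∈ Z e then 1 else 0 := by
      intro e
      have h2 := card_filter_add_card_filter_not (s := Z e) (fun v => v < m)
      rw [← hX, hZh] at h2
      have h3 : ({v ∈ Z e | ¬ v < m} : Finset ℕ) = {v ∈ Ico m n | v ∈ Z e} := by
        ext v
        rw [mem_filter, mem_filter, mem_Ico, not_lt]
        exact ⟨fun hv => ⟨⟨hv.2, mem_range.1 (hZn e hv.1)⟩, hv.1⟩, fun hv => ⟨hv.2, hv.1.1⟩⟩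
      rw [← card_filter, ← h3]
      omega
    rw [sum_congr rfl fun e _ => h1 e, sum_comm, sum_congr rfl fun v hv => by
      rw [← card_filter, filter_filter, hdeg j v (mem_Ico.1 hv).2], sum_const, Nat.card_Ico,
      smul_eq_mul, mul_comm]
  have hmeet : ∀ e f, Meets col Z e f →
      ∃ v ∈ (amalgam lam h m n).ends e, v ∈ (amalgam lam h m n).ends f := by
    rintro e f ⟨_, v, hv, hv'⟩
    by_cases hvm : v < m
    · refine ⟨some ⟨v, hvm⟩, ?_, ?_⟩ <;> rw [some_mem_ends_amalgam, hX, mem_filter]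
      · exact ⟨hv, hvm⟩
      · exact ⟨hv', hvm⟩
    · have key : ∀ e, v ∈ Z e → none ∈ (amalgam lam h m n).ends e := by
        intro e hv
        rw [none_mem_ends_amalgam, hX, ← hZh e]
        exact card_lt_card ((ssubset_iff_of_subset (filter_subset _ _)).2
          ⟨v, hv, fun hh => hvm (mem_filter.1 hh).2⟩)
      exact ⟨none, key e hv, key f hv'⟩
  have hconn : ((amalgam lam h m n).colorClass col j).Connected := by
    refine ⟨⟨none, mem_univ _⟩, fun u _ v _ => ?_⟩
    have hedge : ∀ v, ∃ e, col e = j ∧ v ∈ (amalgam lam h m n).ends e := by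
      rintro (_ | v)
      · have h1 : ∑ e with col e = j, (h - #(ordinaryVertices e)) ≠ 0 := by
          rw [hnone]
          exact (Nat.mul_pos hr (by omega)).ne'
        obtain ⟨e, he, he'⟩ := exists_ne_zero_of_sum_ne_zero h1
        exact ⟨e, (mem_filter.1 he).2, (none_mem_ends_amalgam e).2 (by omega)⟩
      · have h1 := hsome v
        obtain ⟨e, he⟩ := card_pos.1 (h1 ▸ hr)
        obtain ⟨he1, he2⟩ := (mem_filter.1 he).2
        exact ⟨e, he1, (some_mem_ends_amalgam e v).2 he2⟩
    obtain ⟨e, he, hu⟩ := hedge u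
    obtain ⟨f, hf, hv⟩ := hedge v
    refine (hlink j e f he hf).reflTransGen hmeet ?_ hu hv
    intro g hg
    simp only [colorClass, mem_filter, mem_univ, true_and]
    rw [← hg.col_eq, he]
  refine ⟨fun v => by rw [degree_some_amalgam, hsome],
    by rw [degree_none_amalgam, hnone], hconn, ?_⟩
  rw [wingCount_colorClass some_mem_ends_amalgam ordinaryVertices_subset]
  · exact card_image_linkClass_le hmn hr hX hZn j (hdeg j) (hlink j)
  · intro e he
    by_cases heh : #(ordinaryVertices e) < h
    · exact ⟨e, .refl, (none_mem_ends_amalgam e).2 heh⟩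
    · obtain ⟨v, hv⟩ := card_pos.1 (hh.trans_le (not_lt.1 heh))
      have hvm := mem_range.1 (ordinaryVertices_subset e hv)
      exact exists_linked_apex some_mem_ends_amalgam
        (hconn.2 (some ⟨v, hvm⟩) (mem_univ _) none (mem_univ _)) he
        ((some_mem_ends_amalgam e ⟨v, hvm⟩).2 hv)

end Main

end MultiHypergraph

theorem mainTheorem3 (n m h r lam k : ℕ)
    (hh : 0 < h) (hhm : h < m) (hmn : m < n) (hr : 0 < r) (hlam : 0 < lam)
    (hk : k * r = lam * (n - 1).choose (h - 1))
    (c : MultiHypergraph.CompleteEdge lam h (Fin m) → Fin k)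
    (hc : (MultiHypergraph.complete lam h (Fin m)).IsPartialFactorization r c) :
    (∃ d : MultiHypergraph.CompleteEdge lam h (Fin n) → Fin k,
        MultiHypergraph.Extends hmn.le d c ∧
        (MultiHypergraph.complete lam h (Fin n)).IsConnectedFactorization r d) ↔
      ∃ c' : MultiHypergraph.NewEdge lam h m n → Fin k, ∀ j : Fin k,
        (∀ v : Fin m,
          ((MultiHypergraph.amalgam lam h m n).colorClass (Sum.elim c c') j).degree (some v)
            = r) ∧
        ((MultiHypergraph.amalgam lam h m n).colorClass (Sum.elim c c') j).degree none
          = r * (n - m) ∧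
        ((MultiHypergraph.amalgam lam h m n).colorClass (Sum.elim c c') j).Connected ∧
        ((MultiHypergraph.amalgam lam h m n).colorClass (Sum.elim c c') j).wingCount none
          ≤ (r - 1) * (n - m) + 1 := by
  constructor
  · rintro ⟨d, hdc, hd⟩
    exact MultiHypergraph.exists_coloring_of_extension hh hmn hr hdc hd
  · rintro ⟨c', hc'⟩
    -- A colour must exist to serve as the default value in `exists_selection`.
    have hk0 : 0 < k := by
      have h1 : 0 < k * r := by
        rw [hk]
        exact Nat.mul_pos hlam (Nat.choose_pos (by omega))
      exact Nat.pos_of_mul_pos_right h1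
    have : NeZero k := ⟨hk0.ne'⟩
    exact MultiHypergraph.exists_extension_of_amalgam hh hmn hr hc'
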